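/- Let $G\subset \mathrm{GL}_n(\mathbb{R})$ be a real reductive group, i.e. a Zariski connected linear algebraic group over $\mathbb{R}$ whose only normal unipotent algebraic subgroup is $\{1\}$. Let $K\subset G$ be a maximal compact subgroup, with Lie algebras $\mathfrak{k}\subset\mathfrak{g}$. Let $\mathfrak{g}=\mathfrak{k}\oplus\mathfrak{p}$ be the canonical Cartan decomposition with respect to $K$: $\mathfrak{p}=\mathfrak{p}_0\oplus\mathrm{Lie}\,Z_d$, where $Z_d$ is the maximal split subtorus of the center of $G$ and $\mathfrak{p}_0$ is the orthogonal complement of $\mathrm{Lie}\,G^{\mathrm{der}}\cap\mathfrak{k}$ in $\mathrm{Lie}\,G^{\mathrm{der}}$ with respect to the Killing form of $\mathrm{Lie}\,G^{\mathrm{der}}$. Fix an $\mathrm{Ad}(K)$-invariant scalar product $\langle\,,\rangle_{\mathfrak{g}}$ on $\mathfrak{g}$ with $\langle\mathfrak{k},\mathfrak{p}\rangle_{\mathfrak{g}}=0$ for which $\mathrm{ad}(X)$ is skew-symmetric for $X\in\mathfrak{k}$ and symmetric for $X\in\mathfrak{p}$. Let $\rho\colon G\to\mathrm{GL}(V)$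 be an algebraic representation on a finite dimensional real vector space, with differential $\pi\colon\mathfrak{g}\to\mathfrak{gl}(V)$, and let $\bar g=\langle\,,\rangle_V$ be a scalar product on $V$ such that $\rho(K)$ is orthogonal and $\pi(X)$ is symmetric for $X\in\mathfrak{p}$ and skew-symmetric for $X\in\mathfrak{k}$. Let $m\colon V\setminus\{0\}\to\mathfrak{p}$ be the moment map, defined by $\langle m(v),X\rangle_{\mathfrak{g}}=\langle\pi(X)v,v\rangle_V/\langle v,v\rangle_V$ for all $X\in\mathfrak{p}$. For $h\in G$ put $m^{h\cdot\bar g}(v)=\mathrm{Ad}_h\bigl(m(\rho(h)^{-1}v)\bigr)$. For a coset $\bar h=Kh\in K\backslash G$ let $l_{\bar h}\colon G\to K\backslash G$, $g\mapsto Khg$, and let $Dl_{\bar h}\colon\mathfrak{g}\to T_{\bar h}(K\backslash G)$ be its differential at the neutral element; write $m^{\bar h^{-1}\cdot\bar g}:=m^{h^{-1}\cdot\bar g}$, which depends only on $\bar h$. Fix $\bar v\in V\setminus\{0\}$, $h_0\in G$ and $T\in\mathbb{R}_{>0}$, and set $v_0=\rho(h_0)\bar v$ and $\bar h_0=Kh_0$.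 Then there is a bijection between (1) the solutions $v\colon[0,T)\to V\setminus\{0\}$ of the gradient flow $v'(t)=-\pi\bigl(m(v(t))\bigr)v(t)$, $v(0)=v_0$, and (2) the solutions $\bar h\colon[0,T)\to K\backslash G$ of the moment map flow $\frac{d}{dt}\bar h(t)=-Dl_{\bar h(t)}\bigl(m^{\bar h(t)^{-1}\cdot\bar g}(\bar v)\bigr)$, $\bar h(0)=\bar h_0$, such that for corresponding solutions $v$ and $\bar h$ there is a differentiable curve $h\colon[0,T)\to G$ with $h(0)=h_0$ and $h'(t)=-h(t)\cdot m^{h(t)^{-1}\cdot\bar g}(\bar v)$ that satisfies $\bar h(t)=Kh(t)$ and $v(t)=\rho(h(t))\bar v$ for all $t\in[0,T)$. -/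

import Mathlib

open scoped Matrix

attribute [local instance] LieRing.ofAssociativeRing

namespace MomentFlow

/-! ### Linear algebraic groups over the reals, as subgroups of `GL n ℝ` -/

/-- The set `A` is the zero locus in `GL n ℝ` of a set of polynomials in the matrix entries. -/
def IsZariskiClosed {n : ℕ} (A : Set (GL (Fin n) ℝ)) : Prop :=
  ∃ S : Set (MvPolynomial (Fin n × Fin n) ℝ),
    A = {g : GL (Fin n) ℝ | ∀ p ∈ S, MvPolynomial.eval (fun ij => (g : Matrix (Fin n) (Fin n) ℝ) ij.1 ij.2) p = 0}

/-- Linear algebraic groups over `ℝ`. -/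
def IsLinearAlgebraic {n : ℕ} (H : Subgroup (GL (Fin n) ℝ)) : Prop :=
  IsZariskiClosed (H : Set (GL (Fin n) ℝ))

/-- Connectedness in the Zariski topology. -/
def IsZariskiConnected {n : ℕ} (H : Subgroup (GL (Fin n) ℝ)) : Prop :=
  ∀ A B : Set (GL (Fin n) ℝ), IsZariskiClosed A → IsZariskiClosed B →
    (H : Set (GL (Fin n) ℝ)) ⊆ A ∪ B → (H : Set (GL (Fin n) ℝ)) ∩ (A ∩ B) = ∅ →
    (H : Set (GL (Fin n) ℝ)) ⊆ A ∨ (H : Set (GL (Fin n) ℝ)) ⊆ B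

/-- A group of matrices is unipotent if, after a change of basis, it consists of upper triangular
matrices with `1` on the diagonal. -/
def IsUnipotent {n : ℕ} (N : Subgroup (GL (Fin n) ℝ)) : Prop :=
  ∃ P : GL (Fin n) ℝ, ∀ u ∈ N,
    (∀ i j : Fin n, j < i → ((P * u * P⁻¹ : GL (Fin n) ℝ) : Matrix (Fin n) (Fin n) ℝ) i j = 0) ∧
    ∀ i : Fin n, ((P * u * P⁻¹ : GL (Fin n) ℝ) : Matrix (Fin n) (Fin n) ℝ) i i = 1

/-- Real reductive groups: Zariski connected linear algebraic groups over `ℝ` whose only normal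
unipotent algebraic subgroup is the trivial one. -/
structure IsRealReductive {n : ℕ} (G : Subgroup (GL (Fin n) ℝ)) : Prop where
  algebraic : IsLinearAlgebraic G
  connected : IsZariskiConnected G
  no_unipotent : ∀ N : Subgroup (GL (Fin n) ℝ), N ≤ G → (N.subgroupOf G).Normal →
    IsLinearAlgebraic N → IsUnipotent N → N = ⊥

/-- `K` is a maximal compact (abstract) subgroup of `G`. -/
structure IsMaximalCompact {n : ℕ} (G K : Subgroup (GL (Fin n) ℝ)) : Prop where
  le : K ≤ G
  compact : IsCompact (K : Set (GL (Fin n) ℝ))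
  maximal : ∀ L : Subgroup (GL (Fin n) ℝ), L ≤ G → IsCompact (L : Set (GL (Fin n) ℝ)) →
    K ≤ L → L = K

/-- The coordinates on `GL n ℝ`: the matrix entries and the inverse of the determinant. -/
noncomputable def coords {n : ℕ} (g : GL (Fin n) ℝ) : Option (Fin n × Fin n) → ℝ
  | none => ((g : Matrix (Fin n) (Fin n) ℝ).det)⁻¹
  | some ij => (g : Matrix (Fin n) (Fin n) ℝ) ij.1 ij.2

/-- Regular functions on `H`: polynomials in the coordinates of the ambient `GL n ℝ`. -/
def IsRegular {n : ℕ} {H : Subgroup (GL (Fin n) ℝ)} (f : H → ℝ) : Prop :=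
  ∃ p : MvPolynomial (Option (Fin n × Fin n)) ℝ, ∀ g : H, f g = MvPolynomial.eval (coords g.1) p

/-- Algebraic morphisms between subgroups of general linear groups. -/
def IsAlgebraicMap {n m : ℕ} {H : Subgroup (GL (Fin n) ℝ)} {L : Subgroup (GL (Fin m) ℝ)}
    (φ : H → L) : Prop :=
  ∀ i j : Fin m, IsRegular (fun g : H => ((φ g).1 : Matrix (Fin m) (Fin m) ℝ) i j)

/-- The group of invertible diagonal matrices, that is the split torus of rank `k`. -/
noncomputable def diagTorus (k : ℕ) : Subgroup (GL (Fin k) ℝ) :=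
  (Units.map (Matrix.diagonalRingHom (Fin k) ℝ).toMonoidHom).range

/-- Split tori: linear algebraic groups which are algebraically isomorphic to a power of the
multiplicative group. -/
def IsSplitTorus {n : ℕ} (S : Subgroup (GL (Fin n) ℝ)) : Prop :=
  IsLinearAlgebraic S ∧ ∃ (k : ℕ) (e : diagTorus k ≃* S),
    IsAlgebraicMap (fun x => e x) ∧ IsAlgebraicMap (fun x => e.symm x)

/-- The center of `G`, as a subgroup of `GL n ℝ`. -/
def centerGL {n : ℕ} (G : Subgroup (GL (Fin n) ℝ)) : Subgroup (GL (Fin n) ℝ) :=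
  (Subgroup.center G).map G.subtype

/-- The largest split torus in the center of `G` (the supremum of all split tori in the center). -/
def maxSplitCentralTorus {n : ℕ} (G : Subgroup (GL (Fin n) ℝ)) : Subgroup (GL (Fin n) ℝ) :=
  sSup {S | IsSplitTorus S ∧ S ≤ centerGL G}

/-- The derived group as an algebraic group: the smallest linear algebraic group that contains the
commutator subgroup of `G`. -/
def derivedGroup {n : ℕ} (G : Subgroup (GL (Fin n) ℝ)) : Subgroup (GL (Fin n) ℝ) :=
  sInf {L | IsLinearAlgebraic L ∧ ⁅G, G⁆ ≤ L}

/-! ### Tangent spaces and differentials -/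

/-- `γ` is a curve in `H` through the neutral element with velocity `X` at time `0`. -/
def IsTangentCurve {n : ℕ} (H : Subgroup (GL (Fin n) ℝ)) (γ : ℝ → H)
    (X : Matrix (Fin n) (Fin n) ℝ) : Prop :=
  γ 0 = 1 ∧ HasDerivAt (fun t => ((γ t).1 : Matrix (Fin n) (Fin n) ℝ)) X 0

section tangent

attribute [local instance] Matrix.linftyOpNormedRing Matrix.linftyOpNormedAlgebra

variable {n : ℕ} {H : Subgroup (GL (Fin n) ℝ)} {X Y : Matrix (Fin n) (Fin n) ℝ} {γ δ : ℝ → H}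

theorem IsTangentCurve.mul (h : IsTangentCurve H γ X) (h' : IsTangentCurve H δ Y) :
    IsTangentCurve H (fun t => γ t * δ t) (X + Y) := by
  refine ⟨by simp [h.1, h'.1], ?_⟩
  have := HasDerivAt.mul h.2 h'.2
  simpa [h.1, h'.1] using! this

theorem IsTangentCurve.smul (h : IsTangentCurve H γ X) (c : ℝ) :
    IsTangentCurve H (fun t => γ (c * t)) (c • X) := by
  refine ⟨by simp [h.1], ?_⟩
  have h1 : HasDerivAt (fun t : ℝ => c * t) c 0 := by simpa using (hasDerivAt_id (0 : ℝ)).const_mul c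
  have h2 : HasDerivAt (fun t => ((γ t).1 : Matrix (Fin n) (Fin n) ℝ)) X (c * 0) := by
    simpa using h.2
  exact HasDerivAt.scomp (0 : ℝ) h2 h1

theorem IsTangentCurve.conj (h : IsTangentCurve H γ X) (g : H) :
    IsTangentCurve H (fun t => g * γ t * g⁻¹)
      ((g.1 : Matrix (Fin n) (Fin n) ℝ) * X * ((g⁻¹).1 : Matrix (Fin n) (Fin n) ℝ)) := by
  refine ⟨by simp [h.1], ?_⟩
  have := (h.2.const_mul (g.1 : Matrix (Fin n) (Fin n) ℝ)).mul_const
    ((g⁻¹).1 : Matrix (Fin n) (Fin n) ℝ)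
  simpa using! this

theorem IsTangentCurve.inv (h : IsTangentCurve H γ X) :
    HasDerivAt (fun t => (((γ t)⁻¹).1 : Matrix (Fin n) (Fin n) ℝ)) (-X) 0 := by
  have h1 := hasFDerivAt_ringInverse (𝕜 := ℝ) (((γ 0).1 : (Matrix (Fin n) (Fin n) ℝ)ˣ))
  have h2 := h1.comp_hasDerivAt (0 : ℝ) h.2
  have e : (Ring.inverse ∘ fun t => ((γ t).1 : Matrix (Fin n) (Fin n) ℝ)) =
      fun t => (((γ t)⁻¹).1 : Matrix (Fin n) (Fin n) ℝ) := by
    funext t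
    exact Ring.inverse_unit _
  rw [e] at h2
  simpa [h.1] using! h2

theorem IsTangentCurve.tendsto (h : IsTangentCurve H γ X) :
    Filter.Tendsto γ (nhds 0) (nhds (1 : H)) := by
  rw [tendsto_subtype_rng]
  have he : Topology.IsEmbedding (Units.val : (Matrix (Fin n) (Fin n) ℝ)ˣ → _) :=
    Units.isOpenEmbedding_val.isEmbedding
  refine he.tendsto_nhds_iff.mpr ?_
  have := h.2.continuousAt.tendsto
  simpa [h.1] using! this

/-- The tangent space of `H` at the neutral element, as a linear subspace of the space of
matrices. -/
def tangentSpace {n : ℕ} (H : Subgroup (GL (Fin n) ℝ)) :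
    Submodule ℝ (Matrix (Fin n) (Fin n) ℝ) where
  carrier := {X | ∃ γ : ℝ → H, IsTangentCurve H γ X}
  add_mem' := by
    rintro X Y ⟨γ, h⟩ ⟨δ, h'⟩
    exact ⟨_, h.mul h'⟩
  zero_mem' := ⟨fun _ => 1, rfl, hasDerivAt_const _ _⟩
  smul_mem' := by
    rintro c X ⟨γ, h⟩
    exact ⟨_, h.smul c⟩

theorem conj_mem_tangentSpace (g : H) (hX : X ∈ tangentSpace H) :
    (g.1 : Matrix (Fin n) (Fin n) ℝ) * X * ((g⁻¹).1 : Matrix (Fin n) (Fin n) ℝ) ∈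
      tangentSpace H := by
  obtain ⟨γ, h⟩ := hX
  exact ⟨_, h.conj g⟩

theorem lie_mem_tangentSpace (hX : X ∈ tangentSpace H) (hY : Y ∈ tangentSpace H) :
    ⁅X, Y⁆ ∈ tangentSpace H := by
  obtain ⟨γ, h⟩ := hX
  have hd := (h.2.mul_const Y).mul h.inv
  have hcl : IsClosed (tangentSpace H : Set (Matrix (Fin n) (Fin n) ℝ)) :=
    Submodule.closed_of_finiteDimensional _
  have hd' : HasDerivAt (fun t => ((γ t).1 : Matrix (Fin n) (Fin n) ℝ) * Y *
      (((γ t)⁻¹).1 : Matrix (Fin n) (Fin n) ℝ)) ⁅X, Y⁆ 0 := by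
    rw [Ring.lie_def]
    simpa [h.1, sub_eq_add_neg] using! hd
  refine hcl.mem_of_tendsto hd'.tendsto_slope (Filter.Eventually.of_forall fun t => ?_)
  rw [slope_def_module]
  exact Submodule.smul_mem _ _ (Submodule.sub_mem _ (conj_mem_tangentSpace _ hY)
    (conj_mem_tangentSpace _ hY))

end tangent

/-- The Lie algebra of `H`: the tangent space at the neutral element with the commutator. -/
def lieAlg {n : ℕ} (H : Subgroup (GL (Fin n) ℝ)) : LieSubalgebra ℝ (Matrix (Fin n) (Fin n) ℝ) where
  toSubmodule := tangentSpace H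
  lie_mem' := lie_mem_tangentSpace

/-- A curve in `H` through the neutral element that represents the tangent vector `X`. -/
noncomputable def tangentCurve {n : ℕ} {H : Subgroup (GL (Fin n) ℝ)} (X : lieAlg H) : ℝ → H :=
  Classical.choose X.2

/-- The differential at the neutral element of a function on `H`, evaluated at a tangent vector:
the derivative along a curve that represents the tangent vector. -/
noncomputable def diffAtOne {n : ℕ} {H : Subgroup (GL (Fin n) ℝ)} {E : Type*}
    [NormedAddCommGroup E] [NormedSpace ℝ E] (φ : H → E) (X : lieAlg H) : E :=
  deriv (fun t => φ (tangentCurve X t)) 0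

/-- The differential does not depend on the curve that represents the tangent vector, and it is
linear, for every function that extends to a function on matrices differentiable at `1`. -/
theorem exists_diffAtOne {n : ℕ} {H : Subgroup (GL (Fin n) ℝ)} {E : Type*}
    [NormedAddCommGroup E] [NormedSpace ℝ E] (φ : H → E) (F : (Fin n → Fin n → ℝ) → E)
    (hF : DifferentiableAt ℝ F (fun i j => (1 : Matrix (Fin n) (Fin n) ℝ) i j))
    (hφ : ∀ᶠ g in nhds (1 : H), φ g = F (fun i j => (g.1 : Matrix (Fin n) (Fin n) ℝ) i j)) :
    ∃ D : lieAlg H →ₗ[ℝ] E, (∀ X, diffAtOne φ X = D X) ∧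
      ∀ (X : lieAlg H) (γ : ℝ → H), IsTangentCurve H γ X.1 →
        HasDerivAt (fun t => φ (γ t)) (D X) 0 := by
  have key : ∀ (X : lieAlg H) (γ : ℝ → H), IsTangentCurve H γ X.1 →
      HasDerivAt (fun t => φ (γ t)) ((fderiv ℝ F (fun i j => (1 : Matrix (Fin n) (Fin n) ℝ) i j))
        (fun i j => X.1 i j)) 0 := by
    intro X γ hγ
    have h1 : HasDerivAt (fun t => (fun i j => ((γ t).1 : Matrix (Fin n) (Fin n) ℝ) i j :
        Fin n → Fin n → ℝ)) (fun i j => X.1 i j) 0 := hγ.2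
    have h2 : HasFDerivAt F (fderiv ℝ F (fun i j => (1 : Matrix (Fin n) (Fin n) ℝ) i j))
        ((fun t => (fun i j => ((γ t).1 : Matrix (Fin n) (Fin n) ℝ) i j :
        Fin n → Fin n → ℝ)) 0) := by
      simpa [hγ.1] using hF.hasFDerivAt
    have h3 := h2.comp_hasDerivAt (0 : ℝ) h1
    refine h3.congr_of_eventuallyEq ?_
    have hc := hγ.tendsto
    exact hc.eventually hφ
  refine ⟨(fderiv ℝ F (fun i j => (1 : Matrix (Fin n) (Fin n) ℝ) i j)).toLinearMap ∘ₗ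
    (lieAlg H).toSubmodule.subtype, fun X => ?_, key⟩
  exact (key X _ (Classical.choose_spec X.2)).deriv

/-! ### Algebraic representations, their differential, and the adjoint representation -/

/-- Algebraic representations: the matrix coefficients are regular functions. -/
def IsAlgebraicRep {n : ℕ} {G : Subgroup (GL (Fin n) ℝ)} {V : Type*} [AddCommGroup V] [Module ℝ V]
    (ρ : Representation ℝ G V) : Prop :=
  ∀ (v : V) (l : Module.Dual ℝ V), IsRegular (fun g => l (ρ g v))

/-- A regular function extends to a function on matrices that is differentiable at `1`. -/
theorem IsRegular.exists_differentiableAt {n : ℕ} {H : Subgroup (GL (Fin n) ℝ)} {f : H → ℝ}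
    (hf : IsRegular f) : ∃ F : (Fin n → Fin n → ℝ) → ℝ,
      DifferentiableAt ℝ F (fun i j => (1 : Matrix (Fin n) (Fin n) ℝ) i j) ∧
      ∀ g : H, f g = F (fun i j => (g.1 : Matrix (Fin n) (Fin n) ℝ) i j) := by
  obtain ⟨p, hp⟩ := hf
  let C : (Fin n → Fin n → ℝ) → Option (Fin n × Fin n) → ℝ := fun A o =>
    o.elim ((Matrix.det (Matrix.of A))⁻¹) (fun ij => A ij.1 ij.2)
  refine ⟨fun A => MvPolynomial.eval (C A) p, ?_, fun g => ?_⟩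
  · have hC : ∀ o, DifferentiableAt ℝ (fun A => C A o)
        (fun i j => (1 : Matrix (Fin n) (Fin n) ℝ) i j) := by
      rintro (_ | ⟨i, j⟩)
      · refine DifferentiableAt.inv ?_ ?_
        · simp only [Matrix.det_apply, Matrix.of_apply]
          fun_prop
        · change (1 : Matrix (Fin n) (Fin n) ℝ).det ≠ 0
          simp
      · simp only [C, Option.elim]
        fun_prop
    clear hp
    induction p using MvPolynomial.induction_on with
    | C a => simp
    | add p q hp hq =>
      simp only [map_add]
      exact hp.add hq
    | mul_X p o hp =>
      simp only [map_mul, MvPolynomial.eval_X]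
      exact hp.mul (hC o)
  · rw [hp g]
    congr 2
    funext o
    cases o <;> rfl

/-- The orbit maps of an algebraic representation have a differential at the neutral element. -/
theorem IsAlgebraicRep.exists_diffAtOne {n : ℕ} {G : Subgroup (GL (Fin n) ℝ)} {V : Type*}
    [NormedAddCommGroup V] [NormedSpace ℝ V] [FiniteDimensional ℝ V] {ρ : Representation ℝ G V}
    (hρ : IsAlgebraicRep ρ) (v : V) :
    ∃ D : lieAlg G →ₗ[ℝ] V, (∀ X, diffAtOne (fun g => ρ g v) X = D X) ∧
      ∀ (X : lieAlg G) (γ : ℝ → G), IsTangentCurve G γ X.1 →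
        HasDerivAt (fun t => ρ (γ t) v) (D X) 0 := by
  let b := Module.finBasis ℝ V
  choose F hF hφ using fun i => (hρ v (b.coord i)).exists_differentiableAt
  refine MomentFlow.exists_diffAtOne (fun g => ρ g v) (fun A => ∑ i, F i A • b i) ?_
    (Filter.Eventually.of_forall fun g => ?_)
  · exact DifferentiableAt.fun_sum fun i _ => (hF i).smul_const _
  · simp only [← hφ]
    exact (b.sum_repr _).symm

/-- The differential `π = Dρ` of a representation at the neutral element. -/
noncomputable def repDiff {n : ℕ} {G : Subgroup (GL (Fin n) ℝ)} {V : Type*}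
    [NormedAddCommGroup V] [NormedSpace ℝ V] (ρ : Representation ℝ G V) (X : lieAlg G) (v : V) : V :=
  diffAtOne (fun g => ρ g v) X

/-- The adjoint representation. -/
def Ad {n : ℕ} {G : Subgroup (GL (Fin n) ℝ)} (h : G) (X : lieAlg G) : lieAlg G :=
  ⟨(h.1 : Matrix (Fin n) (Fin n) ℝ) * X.1 * ((h⁻¹).1 : Matrix (Fin n) (Fin n) ℝ),
    conj_mem_tangentSpace h X.2⟩

/-! ### The canonical Cartan decomposition -/

/-- The Lie algebra of `K` inside the Lie algebra of `G`. -/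
def cartanK {n : ℕ} (G K : Subgroup (GL (Fin n) ℝ)) : Submodule ℝ (lieAlg G) :=
  (lieAlg K).toSubmodule.comap (lieAlg G).toSubmodule.subtype

/-- The orthogonal complement of `Lie G^der ∩ 𝔨` in `Lie G^der` for the Killing form of
`Lie G^der`. -/
noncomputable def cartanPDer {n : ℕ} (G K : Subgroup (GL (Fin n) ℝ)) :
    Submodule ℝ (Matrix (Fin n) (Fin n) ℝ) :=
  Submodule.map (lieAlg (derivedGroup G)).toSubmodule.subtype
    { carrier := {X : lieAlg (derivedGroup G) | ∀ Y : lieAlg (derivedGroup G), Y.1 ∈ lieAlg K →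
        killingForm ℝ (lieAlg (derivedGroup G)) X Y = 0}
      add_mem' := fun hX hX' Y hY => by simp [hX Y hY, hX' Y hY]
      zero_mem' := fun Y _ => by simp
      smul_mem' := fun c X hX Y hY => by simp [hX Y hY] }

/-- The subspace `𝔭` of the canonical Cartan decomposition `𝔤 = 𝔨 ⊕ 𝔭`. -/
noncomputable def cartanP {n : ℕ} (G K : Subgroup (GL (Fin n) ℝ)) : Submodule ℝ (lieAlg G) :=
  (cartanPDer G K ⊔ (lieAlg (maxSplitCentralTorus G)).toSubmodule).comap
    (lieAlg G).toSubmodule.subtype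

/-- The conditions on the scalar product that is fixed on the Lie algebra of `G`. -/
structure IsLieScalarProduct {n : ℕ} (G K : Subgroup (GL (Fin n) ℝ))
    (B : LinearMap.BilinForm ℝ (lieAlg G)) : Prop where
  symm : ∀ X Y, B X Y = B Y X
  pos : ∀ X, X ≠ 0 → 0 < B X X
  ad_invariant : ∀ k : G, k.1 ∈ K → ∀ X Y, B (Ad k X) (Ad k Y) = B X Y
  orthogonal : ∀ X ∈ cartanK G K, ∀ Y ∈ cartanP G K, B X Y = 0
  skew : ∀ X ∈ cartanK G K, ∀ Y Z, B ⁅X, Y⁆ Z = -B Y ⁅X, Z⁆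
  selfadjoint : ∀ X ∈ cartanP G K, ∀ Y Z, B ⁅X, Y⁆ Z = B Y ⁅X, Z⁆

/-- The conditions on the scalar product of the representation space: `K` acts by orthogonal
maps, `𝔭` by symmetric ones, and `𝔨` by skew-symmetric ones. -/
structure IsAdapted {n : ℕ} (G K : Subgroup (GL (Fin n) ℝ)) {V : Type*} [NormedAddCommGroup V]
    [InnerProductSpace ℝ V] (ρ : Representation ℝ G V) : Prop where
  orthogonal : ∀ k : G, k.1 ∈ K → ∀ v w, inner ℝ (ρ k v) (ρ k w) = inner ℝ v w
  symm : ∀ X ∈ cartanP G K, ∀ v w, inner ℝ (repDiff ρ X v) w = inner ℝ v (repDiff ρ X w)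
  skew : ∀ X ∈ cartanK G K, ∀ v w, inner ℝ (repDiff ρ X v) w = -inner ℝ v (repDiff ρ X w)

/-! ### The moment map and the two flows -/

/-- The defining property of the value `Y = m(v)` of the moment map. -/
def IsMomentAt {n : ℕ} (G K : Subgroup (GL (Fin n) ℝ)) (B : LinearMap.BilinForm ℝ (lieAlg G))
    {V : Type*} [NormedAddCommGroup V] [InnerProductSpace ℝ V] (ρ : Representation ℝ G V)
    (v : V) (Y : lieAlg G) : Prop :=
  Y ∈ cartanP G K ∧ ∀ X ∈ cartanP G K, B Y X = inner ℝ (repDiff ρ X v) v / inner ℝ v v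

/-- The moment map. -/
noncomputable def momentMap {n : ℕ} (G K : Subgroup (GL (Fin n) ℝ))
    (B : LinearMap.BilinForm ℝ (lieAlg G)) {V : Type*} [NormedAddCommGroup V]
    [InnerProductSpace ℝ V] (ρ : Representation ℝ G V) (v : V) : lieAlg G :=
  Classical.epsilon (IsMomentAt G K B ρ v)

/-- Each point has exactly one vector with the defining property of the moment map. -/
theorem existsUnique_isMomentAt {n : ℕ} {G K : Subgroup (GL (Fin n) ℝ)}
    {B : LinearMap.BilinForm ℝ (lieAlg G)} (hB : IsLieScalarProduct G K B)
    {V : Type*} [NormedAddCommGroup V] [InnerProductSpace ℝ V] [FiniteDimensional ℝ V]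
    {ρ : Representation ℝ G V} (hρ : IsAlgebraicRep ρ) (v : V) :
    ∃! Y, IsMomentAt G K B ρ v Y := by
  obtain ⟨D, hD, -⟩ := hρ.exists_diffAtOne v
  let L : cartanP G K →ₗ[ℝ] Module.Dual ℝ (cartanP G K) := B.restrict (cartanP G K)
  have hL : Function.Injective L := by
    refine (injective_iff_map_eq_zero L).mpr fun X hX => ?_
    by_contra hne
    have h1 := hB.pos X.1 (fun h => hne (Subtype.ext h))
    have h2 : L X X = 0 := by rw [hX]; rfl
    exact h1.ne' h2
  have hL' : Function.Surjective L :=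
    (LinearMap.injective_iff_surjective_of_finrank_eq_finrank Subspace.dual_finrank_eq.symm).mp hL
  let ψ : Module.Dual ℝ (cartanP G K) :=
    (inner ℝ v v)⁻¹ • ((innerₗ V v) ∘ₗ D ∘ₗ (cartanP G K).subtype)
  have hψ : ∀ X : cartanP G K, ψ X = inner ℝ (repDiff ρ X.1 v) v / inner ℝ v v := by
    intro X
    have : repDiff ρ X.1 v = D X.1 := hD X.1
    rw [this, real_inner_comm, div_eq_inv_mul]
    rfl
  obtain ⟨Y, hY⟩ := hL' ψ
  refine ⟨Y.1, ⟨Y.2, fun X hX => ?_⟩, ?_⟩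
  · rw [← hψ ⟨X, hX⟩, ← hY]
    rfl
  · rintro Z ⟨hZ, hZ'⟩
    have : (⟨Z, hZ⟩ : cartanP G K) = Y := by
      apply hL
      ext X
      rw [hY, hψ, ← hZ' X.1 X.2]
      rfl
    exact congrArg Subtype.val this

/-- The moment map for the translated scalar product `h·ḡ`, namely `Ad_h(m(ρ(h)⁻¹v))`. -/
noncomputable def momentMapTranslate {n : ℕ} (G K : Subgroup (GL (Fin n) ℝ))
    (B : LinearMap.BilinForm ℝ (lieAlg G)) {V : Type*} [NormedAddCommGroup V]
    [InnerProductSpace ℝ V] (ρ : Representation ℝ G V) (h : G) (v : V) : lieAlg G :=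
  Ad h (momentMap G K B ρ (ρ h⁻¹ v))

/-- The function `u` on `[0,T)` has derivative `u'` at `t` (one-sided at `t = 0`). -/
def HasDerivIco {E : Type*} [AddCommGroup E] [Module ℝ E] [TopologicalSpace E]
    [ContinuousSMul ℝ E] {T : ℝ} (u : Set.Ico 0 T → E) (u' : E) (t : Set.Ico 0 T) : Prop :=
  HasDerivWithinAt (Function.extend Subtype.val u 0) u' (Set.Ico 0 T) t.1

/-- Solutions on `[0,T)` of the gradient flow `v' = -π(m(v))v` on `V ∖ {0}` with `v(0) = v₀`. -/
def IsGradientFlow {n : ℕ} (G K : Subgroup (GL (Fin n) ℝ)) (B : LinearMap.BilinForm ℝ (lieAlg G))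
    {V : Type*} [NormedAddCommGroup V] [InnerProductSpace ℝ V] (ρ : Representation ℝ G V)
    (v₀ : V) {T : ℝ} (hT : 0 < T) (v : Set.Ico 0 T → V) : Prop :=
  (∀ t, v t ≠ 0) ∧ v ⟨0, le_rfl, hT⟩ = v₀ ∧
    ∀ t, HasDerivIco v (-repDiff ρ (momentMap G K B ρ (v t)) (v t)) t

/-- The homogeneous space `K\G` of cosets `Kg`. -/
abbrev LeftQuot {n : ℕ} (G K : Subgroup (GL (Fin n) ℝ)) : Type :=
  Quotient (QuotientGroup.rightRel (K.subgroupOf G))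

/-- The coset `Kg`. -/
abbrev coset {n : ℕ} {G : Subgroup (GL (Fin n) ℝ)} (K : Subgroup (GL (Fin n) ℝ)) (g : G) :
    LeftQuot G K :=
  Quotient.mk (QuotientGroup.rightRel (K.subgroupOf G)) g

/-- Smooth functions on `K\G`: functions whose pull-back to `G` locally extends to a smooth
function of the matrix entries. -/
def IsSmoothOnQuot {n : ℕ} {G K : Subgroup (GL (Fin n) ℝ)} (f : LeftQuot G K → ℝ) : Prop :=
  ∀ g : G, ∃ F : (Fin n → Fin n → ℝ) → ℝ,
    ContDiffAt ℝ (⊤ : ℕ∞) F (fun i j => (g.1 : Matrix (Fin n) (Fin n) ℝ) i j) ∧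
    ∀ᶠ g' in nhds g, f (coset K g') = F (fun i j => (g'.1 : Matrix (Fin n) (Fin n) ℝ) i j)

/-- The map `G → K\G`, `g ↦ Khg`, for a coset `Kh`. -/
def leftTranslate {n : ℕ} {G K : Subgroup (GL (Fin n) ℝ)} (c : LeftQuot G K) (g : G) :
    LeftQuot G K :=
  Quotient.liftOn c (fun h => coset K (h * g)) fun a b hab => by
    refine Quotient.sound ?_
    have hab' : b * a⁻¹ ∈ K.subgroupOf G := QuotientGroup.rightRel_apply.mp hab
    exact QuotientGroup.rightRel_apply.mpr (by simpa [mul_assoc] using hab')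

/-- The tangent vector `D l_{Kh}(X)` of `K\G` at `Kh`, as the derivation that sends a smooth
function `f` on `K\G` to the differential at the neutral element of `g ↦ f(Khg)` in direction
`X`. -/
noncomputable def leftTranslateDiff {n : ℕ} {G K : Subgroup (GL (Fin n) ℝ)} (c : LeftQuot G K)
    (X : lieAlg G) (f : LeftQuot G K → ℝ) : ℝ :=
  diffAtOne (fun g => f (leftTranslate c g)) X

/-- The curve `c` in `K\G` is differentiable at `t` with velocity `ξ`, where tangent vectors of
`K\G` are regarded as derivations on the smooth functions. -/
def HasVelocity {n : ℕ} {G K : Subgroup (GL (Fin n) ℝ)} {T : ℝ} (c : Set.Ico 0 T → LeftQuot G K)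
    (ξ : (LeftQuot G K → ℝ) → ℝ) (t : Set.Ico 0 T) : Prop :=
  ∀ f : LeftQuot G K → ℝ, IsSmoothOnQuot f → HasDerivIco (fun s => f (c s)) (ξ f) t

/-- Solutions on `[0,T)` of the moment map flow on `K\G` that start at `c₀`. The right hand side
is written with an arbitrary representative `h` of the coset `c t = Kh`. -/
def IsMomentMapFlow {n : ℕ} (G K : Subgroup (GL (Fin n) ℝ)) (B : LinearMap.BilinForm ℝ (lieAlg G))
    {V : Type*} [NormedAddCommGroup V] [InnerProductSpace ℝ V] (ρ : Representation ℝ G V)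
    (vbar : V) (c₀ : LeftQuot G K) {T : ℝ} (hT : 0 < T) (c : Set.Ico 0 T → LeftQuot G K) : Prop :=
  c ⟨0, le_rfl, hT⟩ = c₀ ∧
    ∀ t, ∀ h : G, coset K h = c t →
      HasVelocity c (fun f => -leftTranslateDiff (c t) (momentMapTranslate G K B ρ h⁻¹ vbar) f) t

/-- Differentiable curves `h` on `[0,T)` in `G` with `h(0) = h₀` and
`h' = -D l_h (m^{h⁻¹·ḡ}(v̄))`, that is `h' = -h · m^{h⁻¹·ḡ}(v̄)` as matrices. -/
def IsLiftedFlow {n : ℕ} (G K : Subgroup (GL (Fin n) ℝ)) (B : LinearMap.BilinForm ℝ (lieAlg G))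
    {V : Type*} [NormedAddCommGroup V] [InnerProductSpace ℝ V] (ρ : Representation ℝ G V)
    (vbar : V) (h₀ : G) {T : ℝ} (hT : 0 < T) (h : Set.Ico 0 T → G) : Prop :=
  h ⟨0, le_rfl, hT⟩ = h₀ ∧
    ∀ t, HasDerivIco (fun s => ((h s).1 : Matrix (Fin n) (Fin n) ℝ))
      (-(((h t).1 : Matrix (Fin n) (Fin n) ℝ) * (momentMapTranslate G K B ρ (h t)⁻¹ vbar).1)) t

end MomentFlow

/-! Both flows are shadows of one flow on `G`. Since `h · Ad_{h⁻¹} m = m · h`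
(`mul_momentMapTranslate_inv`), the lifted equation reads `h' = -m(ρ(h)v̄) h`. Applying `ρ` to it
shows that `ρ(h)v̄` solves the gradient flow (`orbit_isGradientFlow`), and projecting it shows that
`Kh` solves the moment map flow (`coset_isMomentMapFlow`). The latter needs the `K`-equivariance of
`m` (`momentMap_smul_eq`), which makes the field on `K\G` independent of representatives.

Conversely, each solution lifts. Along a given solution the moment map is a known continuous curve
in `𝔤`, so the equation for `h` becomes linear and has a solution on all of `[0,T)`. This solution
stays in `G` because the ideal of `G` is stable under the derivations `A ↦ XA`, `X ∈ 𝔤`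
(`exists_groupFlow`). For a gradient solution `v`, both `v` and `ρ(h)v̄` solve the same linear
equation `w' = -π(m(v(t)))w`, hence agree (`exists_liftedFlow`). For a solution `c` on `K\G`, both
`c` and `Kh` have the same left invariant velocity. By maximality `K` is the stabilizer in `G` of a
positive definite form `Q`, so `Kg ↦ gᵀQg` is injective and turns the comparison into uniqueness for
a linear matrix equation (`exists_liftedFlow_of_momentMapFlow`).

The gradient field is locally Lipschitz off `0`, so gradient solutions and lifts are unique
(`gradientFlow_unique`, `liftedFlow_unique`); this makes `v ↦ Kh` a bijection. -/

namespace MomentFlow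

/-! ### Linear differential equations on `[0,T)` -/

section linearODE

open Set

variable {E : Type*} [NormedAddCommGroup E] [NormedSpace ℝ E]

/-- A curve on `[0,T)` that starts at `0` and satisfies `‖y'‖ ≤ k(t)‖y‖` with `k` continuous
vanishes. -/
theorem eqOn_zero_of_norm_deriv_le {T : ℝ} {k : ℝ → ℝ} (hk : ContinuousOn k (Ico 0 T))
    {y y' : ℝ → E} (hy : ∀ t ∈ Ico 0 T, HasDerivWithinAt y (y' t) (Ico 0 T) t) (h0 : y 0 = 0)
    (hb : ∀ t ∈ Ico 0 T, ‖y' t‖ ≤ k t * ‖y t‖) : ∀ t ∈ Ico 0 T, y t = 0 := by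
  intro t ht
  have hsub : Icc 0 t ⊆ Ico 0 T := fun s hs => ⟨hs.1, hs.2.trans_lt ht.2⟩
  obtain ⟨C, hC⟩ := isCompact_Icc.exists_bound_of_continuousOn (hk.mono hsub)
  refine eq_zero_of_abs_deriv_le_mul_abs_self_of_eq_zero_right (K := C) (f' := y')
    (fun s hs => ((hy s (hsub hs)).continuousWithinAt).mono hsub) (fun s hs => ?_) h0
    (fun s hs => ?_) t ⟨ht.1, le_rfl⟩
  · have hs' := hsub (Ico_subset_Icc_self hs)
    refine (hy s hs').mono_of_mem_nhdsWithin ?_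
    exact Filter.mem_of_superset (Ico_mem_nhdsGE hs'.2) (Ico_subset_Ico_left hs.1)
  · have hs' := Ico_subset_Icc_self hs
    refine (hb s (hsub hs')).trans ?_
    gcongr
    exact (le_abs_self _).trans (hC s hs')

theorem linearODE_unique {T : ℝ} {A : ℝ → E →L[ℝ] E} (hA : ContinuousOn A (Ico 0 T))
    {y z : ℝ → E} (hy : ∀ t ∈ Ico 0 T, HasDerivWithinAt y (A t (y t)) (Ico 0 T) t)
    (hz : ∀ t ∈ Ico 0 T, HasDerivWithinAt z (A t (z t)) (Ico 0 T) t) (h0 : y 0 = z 0) :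
    ∀ t ∈ Ico 0 T, y t = z t := by
  intro t ht
  have := eqOn_zero_of_norm_deriv_le (y := fun t => y t - z t) hA.norm
    (fun t ht => (hy t ht).sub (hz t ht)) (by simp [h0])
    (fun t _ => by rw [← map_sub]; exact (A t).le_opNorm _) t ht
  exact sub_eq_zero.mp this

variable [CompleteSpace E]

/-- Picard–Lindelöf on the ball of radius `‖x‖` about `x`, where the field is bounded by `2C‖x‖`.
The admissible step length depends on `C` alone and not on `x`, so steps can be chained. -/
theorem exists_linearODE_step {A : ℝ → E →L[ℝ] E} {C a b : ℝ} (hab : a ≤ b)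
    (hA : ContinuousOn A (Icc a b)) (hC : ∀ t ∈ Icc a b, ‖A t‖ ≤ C) (hCb : 2 * C * (b - a) ≤ 1)
    (x : E) : ∃ y : ℝ → E, y a = x ∧
      ∀ t ∈ Icc a b, HasDerivWithinAt y (A t (y t)) (Icc a b) t := by
  have hC0 : 0 ≤ C := (norm_nonneg _).trans (hC a ⟨le_rfl, hab⟩)
  have h : IsPicardLindelof (fun t => (A t : E → E)) (⟨a, le_rfl, hab⟩ : Icc a b) x ‖x‖₊ 0
      (2 * ⟨C, hC0⟩ * ‖x‖₊) ⟨C, hC0⟩ := by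
    refine ⟨fun t ht => ?_, fun z _ => hA.clm_apply continuousOn_const, fun t ht z hz => ?_, ?_⟩
    · exact ((A t).lipschitz.weaken (show ‖A t‖₊ ≤ ⟨C, hC0⟩ from hC t ht)).lipschitzOnWith
    · have h1 : ‖z‖ ≤ 2 * ‖x‖ := by
        have h2 := mem_closedBall_iff_norm.mp hz
        have h3 := norm_le_norm_add_norm_sub' z x
        simp only [coe_nnnorm] at h2
        linarith
      calc ‖A t z‖ ≤ ‖A t‖ * ‖z‖ := (A t).le_opNorm z
        _ ≤ C * (2 * ‖x‖) := by gcongr; exact hC t ht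
        _ = 2 * C * ‖x‖ := by ring
        _ = _ := rfl
    · have h1 : max (b - a) (a - a) = b - a := by simp [hab]
      simp only [h1, NNReal.coe_mul, coe_nnnorm, NNReal.coe_zero, sub_zero]
      change 2 * C * ‖x‖ * (b - a) ≤ ‖x‖
      nlinarith [norm_nonneg x, mul_le_mul_of_nonneg_right hCb (norm_nonneg x)]
  exact h.exists_eq_forall_mem_Icc_hasDerivWithinAt₀

theorem exists_linearODE_Icc {A : ℝ → E →L[ℝ] E} {b : ℝ} (hb : 0 ≤ b)
    (hA : ContinuousOn A (Icc 0 b)) (x : E) : ∃ y : ℝ → E, y 0 = x ∧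
      ∀ t ∈ Icc 0 b, HasDerivWithinAt y (A t (y t)) (Icc 0 b) t := by
  obtain ⟨C, hC⟩ := isCompact_Icc.exists_bound_of_continuousOn hA
  have hC0 : 0 ≤ C := (norm_nonneg _).trans (hC 0 ⟨le_rfl, hb⟩)
  -- `N` equal steps of length `b / N`, each short enough for `exists_linearODE_step`.
  obtain ⟨N, hN⟩ := exists_nat_gt (2 * C * b)
  have hN0 : (0 : ℝ) < N := lt_of_le_of_lt (by positivity) hN
  have hN' : 2 * C * (b / N) ≤ 1 := by
    rw [← mul_div_assoc, div_le_one hN0]; exact hN.le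
  have hε : 0 ≤ b / N := by positivity
  have key : ∀ k : ℕ, k ≤ N → ∃ y : ℝ → E, y 0 = x ∧
      ∀ t ∈ Icc 0 (k * (b / N)), HasDerivWithinAt y (A t (y t)) (Icc 0 (k * (b / N))) t := by
    intro k
    induction k with
    | zero =>
      intro _
      refine ⟨fun _ => x, rfl, fun t ht => ?_⟩
      have : Icc (0 : ℝ) ((0 : ℕ) * (b / N)) = {0} := by simp
      rw [this] at ht ⊢
      rw [mem_singleton_iff.mp ht]
      exact HasFDerivWithinAt.of_subsingleton subsingleton_singleton
    | succ k ih =>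
      intro hk
      obtain ⟨y, hy0, hy⟩ := ih (by omega)
      set c : ℝ := k * (b / N) with hc
      have hc0 : 0 ≤ c := by positivity
      have hc' : ((k + 1 : ℕ) : ℝ) * (b / N) = c + b / N := by push_cast; ring
      have hcb : c + b / N ≤ b := by
        rw [← hc']
        calc ((k + 1 : ℕ) : ℝ) * (b / N) ≤ N * (b / N) := by gcongr
          _ = b := by field_simp
      have hsub : Icc c (c + b / N) ⊆ Icc 0 b := Icc_subset_Icc hc0 hcb
      obtain ⟨z, hz0, hz⟩ := exists_linearODE_step (by linarith) (hA.mono hsub)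
        (fun t ht => hC t (hsub ht)) (by simpa using hN') (y c)
      rw [hc']
      have hun : Icc 0 (c + b / N) = Icc 0 c ∪ Icc c (c + b / N) :=
        (Icc_union_Icc_eq_Icc hc0 (by linarith)).symm
      let w : ℝ → E := fun t => if t ≤ c then y t else z t
      have hwy : EqOn w y (Icc 0 c) := fun t ht => if_pos ht.2
      have hwz : EqOn w z (Icc c (c + b / N)) := fun t ht => by
        rcases ht.1.eq_or_lt with h | h
        · subst h; simp [w, hz0]
        · exact if_neg h.not_ge
      refine ⟨w, by simp [w, hc0, hy0], fun t ht => ?_⟩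
      rw [hun] at ht ⊢
      -- Outside a closed interval the derivative within it is a vacuous condition, so both pieces
      -- can be checked at every `t`, and they join at `c`.
      have h1 : HasDerivWithinAt w (A t (w t)) (Icc 0 c) t := by
        by_cases h : t ∈ Icc 0 c
        · rw [hwy h]; exact (hy t h).congr hwy (hwy h)
        · exact (HasFDerivWithinAt.of_notMem_closure
            (by rwa [isClosed_Icc.closure_eq]))
      have h2 : HasDerivWithinAt w (A t (w t)) (Icc c (c + b / N)) t := by
        by_cases h : t ∈ Icc c (c + b / N)
        · rw [hwz h]; exact (hz t h).congr hwz (hwz h)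
        · exact (HasFDerivWithinAt.of_notMem_closure
            (by rwa [isClosed_Icc.closure_eq]))
      exact h1.union h2
  obtain ⟨y, hy0, hy⟩ := key N le_rfl
  have : (N : ℝ) * (b / N) = b := by field_simp
  rw [this] at hy
  exact ⟨y, hy0, hy⟩

theorem exists_linearODE {A : ℝ → E →L[ℝ] E} {T : ℝ}
    (hA : ContinuousOn A (Ico 0 T)) (x : E) : ∃ y : ℝ → E, y 0 = x ∧
      ∀ t ∈ Ico 0 T, HasDerivWithinAt y (A t (y t)) (Ico 0 T) t := by
  have hsub : ∀ b ∈ Ico 0 T, Icc 0 b ⊆ Ico 0 T := fun b hb s hs => ⟨hs.1, hs.2.trans_lt hb.2⟩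
  choose! y hy0 hy using fun (b : ℝ) (hb : b ∈ Ico 0 T) =>
    exists_linearODE_Icc hb.1 (hA.mono (hsub b hb)) x
  have huniq : ∀ b ∈ Ico 0 T, ∀ b' ∈ Ico 0 T, b ≤ b' → ∀ t ∈ Ico 0 b, y b t = y b' t := by
    intro b hb b' hb' hbb' t ht
    have hs : Ico 0 b ⊆ Icc 0 b' := fun s hs => ⟨hs.1, hs.2.le.trans hbb'⟩
    exact linearODE_unique (hA.mono (hs.trans (hsub b' hb')))
      (fun s hs => (hy b hb s (Ico_subset_Icc_self hs)).mono Ico_subset_Icc_self)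
      (fun s hs' => (hy b' hb' s (hs hs')).mono hs) ((hy0 b hb).trans (hy0 b' hb').symm) t ht
  have hmid : ∀ t ∈ Ico 0 T, (t + T) / 2 ∈ Ico 0 T ∧ t < (t + T) / 2 := fun t ht =>
    ⟨⟨by linarith [ht.1, ht.2], by linarith [ht.2]⟩, by linarith [ht.2]⟩
  -- The value at `t` is read from the solution on `[0, (t + T) / 2]`, which reaches beyond `t`;
  -- uniqueness makes these choices consistent. For `T ≤ 0` the interval is empty and only the value
  -- at `0` matters.
  refine ⟨fun t => if 0 < T then y ((t + T) / 2) t else x, ?_, fun t ht => ?_⟩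
  · by_cases hT : 0 < T
    · simpa [hT] using hy0 _ (hmid 0 ⟨le_rfl, hT⟩).1
    · simp [hT]
  · have hT : 0 < T := ht.1.trans_lt ht.2
    simp only [hT, if_true]
    obtain ⟨hb, htb⟩ := hmid t ht
    set b := (t + T) / 2 with hbdef
    have h1 : HasDerivWithinAt (y b) (A t (y b t)) (Ico 0 T) t :=
      (hy b hb t ⟨ht.1, htb.le⟩).mono_of_mem_nhdsWithin
        (Filter.mem_of_superset (inter_mem_nhdsWithin _ (Iio_mem_nhds htb))
          fun s hs => ⟨hs.1.1, (show s < b from hs.2).le⟩)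
    refine h1.congr_of_eventuallyEq ?_ rfl
    filter_upwards [inter_mem_nhdsWithin (Ico 0 T) (Iio_mem_nhds htb)] with s hs
    obtain ⟨hb', hsb'⟩ := hmid s hs.1
    rcases le_total ((s + T) / 2) b with h | h
    · exact huniq _ hb' _ hb h s ⟨hs.1.1, hsb'⟩
    · exact (huniq _ hb _ hb' h s ⟨hs.1.1, hs.2⟩).symm

end linearODE

/-! ### Matrix differential equations in linear algebraic groups -/

section groupODE

open Set

attribute [local instance] Matrix.linftyOpNormedRing Matrix.linftyOpNormedAlgebra

variable {n : ℕ}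

/-- A derivative depends only on the topology of the matrix space, so the operator norm and the sup
norm of `Fin n → Fin n → ℝ` may be exchanged freely. -/
theorem hasDerivWithinAt_matrix_iff {A : ℝ → Matrix (Fin n) (Fin n) ℝ}
    {A' : Matrix (Fin n) (Fin n) ℝ} {s : Set ℝ} {t : ℝ} :
    HasDerivWithinAt A A' s t ↔ ∀ i j, HasDerivWithinAt (fun t => A t i j) (A' i j) s t := by
  constructor
  · intro h i j
    have h1 : HasDerivWithinAt (fun t => (A t : Fin n → Fin n → ℝ)) A' s t := h
    exact hasDerivWithinAt_pi.mp (hasDerivWithinAt_pi.mp h1 i) j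
  · intro h
    have h1 : HasDerivWithinAt (fun t => (A t : Fin n → Fin n → ℝ)) A' s t :=
      hasDerivWithinAt_pi.mpr fun i => hasDerivWithinAt_pi.mpr fun j => h i j
    exact h1

/-- The derivation of polynomial functions on matrices along the vector field `A ↦ X * A`. -/
noncomputable def leftMulDerivation (X : Matrix (Fin n) (Fin n) ℝ) :
    Derivation ℝ (MvPolynomial (Fin n × Fin n) ℝ) (MvPolynomial (Fin n × Fin n) ℝ) :=
  MvPolynomial.mkDerivation ℝ fun ij =>
    ∑ k, MvPolynomial.C (X ij.1 k) * MvPolynomial.X (k, ij.2)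

/-- The value of a polynomial at a matrix. -/
noncomputable abbrev evalMatrix (A : Matrix (Fin n) (Fin n) ℝ) :
    MvPolynomial (Fin n × Fin n) ℝ →+* ℝ :=
  MvPolynomial.eval fun ij => A ij.1 ij.2

theorem hasDerivWithinAt_evalMatrix {A : ℝ → Matrix (Fin n) (Fin n) ℝ}
    {X : Matrix (Fin n) (Fin n) ℝ} {s : Set ℝ} {t : ℝ} (h : HasDerivWithinAt A (X * A t) s t)
    (p : MvPolynomial (Fin n × Fin n) ℝ) :
    HasDerivWithinAt (fun t => evalMatrix (A t) p) (evalMatrix (A t) (leftMulDerivation X p)) s t := by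
  induction p using MvPolynomial.induction_on with
  | C a => simpa using hasDerivWithinAt_const t s a
  | add p q hp hq => simpa using! hp.add hq
  | mul_X p ij hp =>
    have h1 := hasDerivWithinAt_matrix_iff.mp h ij.1 ij.2
    have h2 := hp.mul h1
    simp only [map_mul, MvPolynomial.eval_X, Derivation.leibniz, smul_eq_mul, map_add]
    convert! h2 using 1
    simp [leftMulDerivation, MvPolynomial.mkDerivation_X, Matrix.mul_apply]
    ring

/-- Allows the derivation along a moving `Y(t)` to be expanded in a fixed basis of the Lie algebra.
-/
theorem leftMulDerivation_sum {ι : Type*} (s : Finset ι) (c : ι → ℝ)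
    (X : ι → Matrix (Fin n) (Fin n) ℝ) (p : MvPolynomial (Fin n × Fin n) ℝ) :
    leftMulDerivation (∑ k ∈ s, c k • X k) p =
      ∑ k ∈ s, MvPolynomial.C (c k) * leftMulDerivation (X k) p := by
  induction p using MvPolynomial.induction_on with
  | C a => simp [MvPolynomial.derivation_C]
  | add p q hp hq => simp [hp, hq, mul_add, Finset.sum_add_distrib]
  | mul_X p ij hp =>
    have : leftMulDerivation (∑ k ∈ s, c k • X k) (MvPolynomial.X ij) =
        ∑ k ∈ s, MvPolynomial.C (c k) * leftMulDerivation (X k) (MvPolynomial.X ij) := by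
      simp only [leftMulDerivation, MvPolynomial.mkDerivation_X, Matrix.sum_apply,
        Matrix.smul_apply, smul_eq_mul, map_sum, map_mul, Finset.sum_mul, Finset.mul_sum]
      rw [Finset.sum_comm]
      simp only [mul_assoc]
    simp only [Derivation.leibniz, smul_eq_mul, hp, this, mul_add, Finset.sum_add_distrib,
      Finset.mul_sum]
    congr 1 <;> exact Finset.sum_congr rfl fun k _ => by ring

/-- The ideal of polynomials that vanish on `G`. -/
noncomputable def vanishingIdeal (G : Subgroup (GL (Fin n) ℝ)) : Ideal (MvPolynomial (Fin n × Fin n) ℝ) :=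
  ⨅ g : G, RingHom.ker (evalMatrix (g.1 : Matrix (Fin n) (Fin n) ℝ))

theorem mem_vanishingIdeal {G : Subgroup (GL (Fin n) ℝ)} {p : MvPolynomial (Fin n × Fin n) ℝ} :
    p ∈ vanishingIdeal G ↔ ∀ g : G, evalMatrix (g.1 : Matrix (Fin n) (Fin n) ℝ) p = 0 := by
  simp [vanishingIdeal, Submodule.mem_iInf, RingHom.mem_ker]

/-- If `γ` is a curve in `G` with velocity `X` at `1`, then `p` vanishes along `t ↦ γ(t)g`, and the
derivative of this zero function at `0` is the value of `leftMulDerivation X p` at `g`. -/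
theorem leftMulDerivation_mem_vanishingIdeal {G : Subgroup (GL (Fin n) ℝ)}
    {X : Matrix (Fin n) (Fin n) ℝ} (hX : X ∈ tangentSpace G)
    {p : MvPolynomial (Fin n × Fin n) ℝ} (hp : p ∈ vanishingIdeal G) :
    leftMulDerivation X p ∈ vanishingIdeal G := by
  rw [mem_vanishingIdeal] at hp ⊢
  intro g
  obtain ⟨γ, hγ⟩ := hX
  have h1 := (hγ.2.mul_const (g.1 : Matrix (Fin n) (Fin n) ℝ)).hasDerivWithinAt (s := univ)
  have h2 := hasDerivWithinAt_evalMatrix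
    (A := fun t => ((γ t).1 : Matrix (Fin n) (Fin n) ℝ) * (g.1 : Matrix (Fin n) (Fin n) ℝ))
    (X := X) (t := 0) (s := univ) (by convert! h1 using 1; simp [hγ.1]) p
  have h3 : (fun t => evalMatrix (((γ t).1 : Matrix (Fin n) (Fin n) ℝ) *
      (g.1 : Matrix (Fin n) (Fin n) ℝ)) p) = fun _ => 0 := by
    funext t
    exact hp (γ t * g)
  rw [h3] at h2
  have h4 := (hasDerivWithinAt_univ.mp h2).unique (hasDerivAt_const (0 : ℝ) (0 : ℝ))
  simpa [hγ.1] using! h4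

/-- A solution of `A' = Y A` with `Y(t)` in the Lie algebra of `G` that starts in `G` satisfies the
equations of `G`. -/
theorem evalMatrix_eq_zero_of_flow {G : Subgroup (GL (Fin n) ℝ)} {T : ℝ}
    {Y A : ℝ → Matrix (Fin n) (Fin n) ℝ} (hY : ContinuousOn Y (Ico 0 T))
    (hYG : ∀ t ∈ Ico 0 T, Y t ∈ tangentSpace G)
    (hA : ∀ t ∈ Ico 0 T, HasDerivWithinAt A (Y t * A t) (Ico 0 T) t)
    (h0 : ∃ g : G, A 0 = (g.1 : Matrix (Fin n) (Fin n) ℝ)) {t : ℝ} (ht : t ∈ Ico 0 T)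
    {p : MvPolynomial (Fin n × Fin n) ℝ} (hp : p ∈ vanishingIdeal G) :
    evalMatrix (A t) p = 0 := by
  -- By Hilbert's basis theorem finitely many `f i` generate the ideal. Their values along `A`
  -- satisfy a homogeneous linear system, because the derivations map each `f i` back into the
  -- ideal.
  obtain ⟨r, f, hf⟩ := Submodule.fg_iff_exists_fin_generating_family.mp
    ((isNoetherianRing_iff_ideal_fg _).mp inferInstance (vanishingIdeal G))
  have hfI : ∀ i, f i ∈ vanishingIdeal G := fun i => by
    rw [← hf]; exact Submodule.subset_span ⟨i, rfl⟩
  let b := Module.finBasis ℝ (tangentSpace G)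
  have hq : ∀ k i, ∃ q : Fin r → MvPolynomial (Fin n × Fin n) ℝ,
      ∑ j, q j • f j = leftMulDerivation (b k).1 (f i) := fun k i =>
    (Submodule.mem_span_range_iff_exists_fun _).mp
      (by rw [hf]; exact leftMulDerivation_mem_vanishingIdeal (b k).2 (hfI i))
  choose q hq using hq
  -- The coordinates on the Lie algebra are extended to all matrices, so that they can be composed
  -- with the matrix-valued curve `Y`.
  choose c hc using fun k => LinearMap.exists_extend (b.coord k)
  have hsum : ∀ X ∈ tangentSpace G, X = ∑ k, c k X • (b k).1 := fun X hX => by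
    have h1 := congrArg Subtype.val (b.sum_repr ⟨X, hX⟩)
    have h2 : ∀ k, c k X = b.repr ⟨X, hX⟩ k := fun k => by
      have := LinearMap.congr_fun (hc k) ⟨X, hX⟩
      simpa using this
    simp only [h2]
    rw [Submodule.coe_sum] at h1
    exact h1.symm
  have hAc : ContinuousOn A (Ico 0 T) := fun t ht => (hA t ht).continuousWithinAt
  have hev : ∀ p, ContinuousOn (fun t => evalMatrix (A t) p) (Ico 0 T) := fun p t ht =>
    (hasDerivWithinAt_evalMatrix (hA t ht) p).continuousWithinAt
  have hcc : ∀ k, ContinuousOn (fun t => c k (Y t)) (Ico 0 T) := fun k =>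
    (LinearMap.continuous_of_finiteDimensional (c k)).comp_continuousOn hY
  let y : ℝ → Fin r → ℝ := fun t i => evalMatrix (A t) (f i)
  let y' : ℝ → Fin r → ℝ := fun t i => evalMatrix (A t) (leftMulDerivation (Y t) (f i))
  -- The sum of the absolute values of the coefficients of the linear system for `y`; it bounds
  -- `‖y'‖ / ‖y‖` in the sup norm.
  let κ : ℝ → ℝ := fun t => ∑ i, ∑ k, |c k (Y t)| * ∑ j, |evalMatrix (A t) (q k i j)|
  have hκ : ContinuousOn κ (Ico 0 T) := by
    refine continuousOn_finsetSum _ fun i _ => continuousOn_finsetSum _ fun k _ => ?_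
    exact (hcc k).abs.mul (continuousOn_finsetSum _ fun j _ => (hev _).abs)
  have hy0 : y 0 = 0 := by
    obtain ⟨g, hg⟩ := h0
    funext i
    simp only [y, hg]
    exact mem_vanishingIdeal.mp (hfI i) g
  have hyd : ∀ t ∈ Ico 0 T, HasDerivWithinAt y (y' t) (Ico 0 T) t := fun t ht =>
    hasDerivWithinAt_pi.mpr fun i => hasDerivWithinAt_evalMatrix (hA t ht) (f i)
  have hyb : ∀ t ∈ Ico 0 T, ‖y' t‖ ≤ κ t * ‖y t‖ := by
    intro t ht
    have hκi : ∀ i, 0 ≤ ∑ k, |c k (Y t)| * ∑ j, |evalMatrix (A t) (q k i j)| := fun i => by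
      positivity
    refine (pi_norm_le_iff_of_nonneg (mul_nonneg (Finset.sum_nonneg fun i _ => hκi i)
      (norm_nonneg _))).mpr fun i => ?_
    have h1 : y' t i = ∑ k, c k (Y t) * ∑ j, evalMatrix (A t) (q k i j) * y t j := by
      simp only [y', y]
      rw [hsum _ (hYG t ht), leftMulDerivation_sum, map_sum]
      simp only [← hsum _ (hYG t ht)]
      refine Finset.sum_congr rfl fun k _ => ?_
      rw [← hq k i]
      simp
    rw [h1]
    calc ‖∑ k, c k (Y t) * ∑ j, evalMatrix (A t) (q k i j) * y t j‖
        ≤ ∑ k, |c k (Y t)| * ∑ j, |evalMatrix (A t) (q k i j)| * ‖y t‖ := by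
          refine (norm_sum_le _ _).trans (Finset.sum_le_sum fun k _ => ?_)
          rw [norm_mul]
          refine mul_le_mul_of_nonneg_left ?_ (norm_nonneg _)
          refine (norm_sum_le _ _).trans (Finset.sum_le_sum fun j _ => ?_)
          rw [norm_mul]
          exact mul_le_mul_of_nonneg_left (norm_le_pi_norm _ j) (norm_nonneg _)
      _ = (∑ k, |c k (Y t)| * ∑ j, |evalMatrix (A t) (q k i j)|) * ‖y t‖ := by
          rw [Finset.sum_mul]
          exact Finset.sum_congr rfl fun k _ => by rw [← Finset.sum_mul, mul_assoc]
      _ ≤ κ t * ‖y t‖ := by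
          refine mul_le_mul_of_nonneg_right ?_ (norm_nonneg _)
          exact Finset.single_le_sum (f := fun i => ∑ k, |c k (Y t)| *
            ∑ j, |evalMatrix (A t) (q k i j)|) (fun i _ => hκi i) (Finset.mem_univ i)
  have hyz := eqOn_zero_of_norm_deriv_le hκ hyd hy0 hyb t ht
  rw [← hf] at hp
  obtain ⟨a, rfl⟩ := (Submodule.mem_span_range_iff_exists_fun _).mp hp
  simp only [smul_eq_mul, map_sum, map_mul]
  exact Finset.sum_eq_zero fun i _ => by
    have : evalMatrix (A t) (f i) = 0 := congrFun hyz i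
    simp [this]

/-- In a linear algebraic group the equation `h' = Y h`, with `Y` a continuous curve in the Lie
algebra, has a solution for each initial value. -/
theorem exists_groupFlow {G : Subgroup (GL (Fin n) ℝ)} (hG : IsLinearAlgebraic G) {T : ℝ}
    {Y : ℝ → Matrix (Fin n) (Fin n) ℝ} (hY : ContinuousOn Y (Ico 0 T))
    (hYG : ∀ t ∈ Ico 0 T, Y t ∈ tangentSpace G) (h₀ : G) :
    ∃ h : ℝ → G, h 0 = h₀ ∧ ∀ t ∈ Ico 0 T,
      HasDerivWithinAt (fun s => ((h s).1 : Matrix (Fin n) (Fin n) ℝ))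
        (Y t * ((h t).1 : Matrix (Fin n) (Fin n) ℝ)) (Ico 0 T) t := by
  have : CompleteSpace (Matrix (Fin n) (Fin n) ℝ) := FiniteDimensional.complete ℝ _
  obtain ⟨A, hA0, hA⟩ := exists_linearODE
    (A := fun t => ContinuousLinearMap.mul ℝ (Matrix (Fin n) (Fin n) ℝ) (Y t))
    ((ContinuousLinearMap.continuous _).comp_continuousOn hY)
    ((h₀.1 : Matrix (Fin n) (Fin n) ℝ))
  -- `W` is the prospective inverse of `A`: from `W' = -WY` and `A' = YA` the product `WA` has
  -- derivative zero.
  obtain ⟨W, hW0, hW⟩ := exists_linearODE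
    (A := fun t => (ContinuousLinearMap.mul ℝ (Matrix (Fin n) (Fin n) ℝ)).flip (-Y t))
    ((ContinuousLinearMap.continuous _).comp_continuousOn hY.neg)
    (((h₀⁻¹).1 : Matrix (Fin n) (Fin n) ℝ))
  have hA : ∀ t ∈ Ico 0 T, HasDerivWithinAt A (Y t * A t) (Ico 0 T) t := hA
  have hW : ∀ t ∈ Ico 0 T, HasDerivWithinAt W (W t * -Y t) (Ico 0 T) t := hW
  have hWA0 : W 0 * A 0 = 1 := by
    rw [hW0, hA0]
    exact Units.inv_mul h₀.1
  have hWA : ∀ t ∈ Ico 0 T, W t * A t = 1 := by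
    intro t ht
    refine linearODE_unique (A := fun _ => 0) (y := fun s => W s * A s) (z := fun _ => 1)
      continuousOn_const (fun s hs => ?_)
      (fun s _ => hasDerivWithinAt_const _ _ _) hWA0 t ht
    have h2 := (hW s hs).mul (hA s hs)
    convert! h2 using 1
    simp [mul_assoc]
  obtain ⟨S, hS⟩ := hG
  have hmem : ∀ t ∈ Ico 0 T, ∃ g : G, (g.1 : Matrix (Fin n) (Fin n) ℝ) = A t := by
    intro t ht
    let u : GL (Fin n) ℝ := ⟨A t, W t, mul_eq_one_comm.mp (hWA t ht), hWA t ht⟩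
    refine ⟨⟨u, ?_⟩, rfl⟩
    change u ∈ (G : Set (GL (Fin n) ℝ))
    rw [hS]
    intro p hp
    refine evalMatrix_eq_zero_of_flow hY hYG hA ⟨h₀, hA0⟩ ht (mem_vanishingIdeal.mpr fun g => ?_)
    have hg : g.1 ∈ (G : Set (GL (Fin n) ℝ)) := g.2
    rw [hS] at hg
    exact hg p hp
  choose! g hg using hmem
  have hg0 : 0 < T → g 0 = h₀ := fun hT => by
    refine Subtype.ext (Units.ext ?_)
    rw [hg 0 ⟨le_rfl, hT⟩, hA0]
  refine ⟨fun t => if 0 < T then g t else h₀, ?_, fun t ht => ?_⟩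
  · by_cases hT : 0 < T <;> simp [hT, hg0]
  · have hT : 0 < T := ht.1.trans_lt ht.2
    simp only [hT, if_true]
    rw [hg t ht]
    exact (hA t ht).congr hg (hg t ht)

end groupODE

/-! ### Smoothness of algebraic representations -/

section smooth

variable {n : ℕ}

theorem contDiff_matrix_det {m : WithTop ℕ∞} :
    ContDiff ℝ m (fun A : Fin n → Fin n → ℝ => (Matrix.of A).det) := by
  simp only [Matrix.det_apply, Matrix.of_apply]
  fun_prop

/-- One extension, smooth on the whole locus `det ≠ 0`, serves at every point of `H` and not only at
`1`. -/
theorem IsRegular.exists_contDiffAt {H : Subgroup (GL (Fin n) ℝ)} {f : H → ℝ}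
    (hf : IsRegular f) : ∃ F : (Fin n → Fin n → ℝ) → ℝ,
      (∀ A, (Matrix.of A).det ≠ 0 → ContDiffAt ℝ (⊤ : ℕ∞) F A) ∧
      ∀ g : H, f g = F (fun i j => (g.1 : Matrix (Fin n) (Fin n) ℝ) i j) := by
  obtain ⟨p, hp⟩ := hf
  let C : (Fin n → Fin n → ℝ) → Option (Fin n × Fin n) → ℝ := fun A o =>
    o.elim ((Matrix.det (Matrix.of A))⁻¹) (fun ij => A ij.1 ij.2)
  refine ⟨fun A => MvPolynomial.eval (C A) p, fun A hA => ?_, fun g => ?_⟩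
  · have hC : ∀ o, ContDiffAt ℝ (⊤ : ℕ∞) (fun A => C A o) A := by
      rintro (_ | ⟨i, j⟩)
      · exact contDiff_matrix_det.contDiffAt.inv hA
      · simp only [C, Option.elim]
        fun_prop
    clear hp
    induction p using MvPolynomial.induction_on with
    | C a => simpa using contDiffAt_const
    | add p q hp hq =>
      simp only [map_add]
      exact hp.add hq
    | mul_X p o hp =>
      simp only [map_mul, MvPolynomial.eval_X]
      exact hp.mul (hC o)
  · rw [hp g]
    congr 2
    funext o
    cases o <;> rfl

theorem det_coe_ne_zero (g : GL (Fin n) ℝ) :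
    (Matrix.of fun i j => (g : Matrix (Fin n) (Fin n) ℝ) i j).det ≠ 0 :=
  ((Matrix.isUnit_iff_isUnit_det _).mp g.isUnit).ne_zero

variable {G : Subgroup (GL (Fin n) ℝ)} {V : Type*} [NormedAddCommGroup V]

theorem IsAlgebraicRep.exists_contDiffAt [NormedSpace ℝ V] [FiniteDimensional ℝ V]
    {ρ : Representation ℝ G V} (hρ : IsAlgebraicRep ρ) (v : V) :
    ∃ F : (Fin n → Fin n → ℝ) → V,
      (∀ A, (Matrix.of A).det ≠ 0 → ContDiffAt ℝ (⊤ : ℕ∞) F A) ∧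
      ∀ g : G, ρ g v = F (fun i j => (g.1 : Matrix (Fin n) (Fin n) ℝ) i j) := by
  let b := Module.finBasis ℝ V
  choose F hF hφ using fun i => (hρ v (b.coord i)).exists_contDiffAt
  refine ⟨fun A => ∑ i, F i A • b i, fun A hA => ?_, fun g => ?_⟩
  · exact ContDiffAt.sum fun i _ => (hF i A hA).smul contDiffAt_const
  · simp only [← hφ]
    exact (b.sum_repr _).symm

/-- The derivative, along a curve in `G`, of a function of the matrix entries. -/
theorem hasDerivWithinAt_comp_entries {E : Type*} [NormedAddCommGroup E] [NormedSpace ℝ E]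
    {F : (Fin n → Fin n → ℝ) → E} {h : ℝ → G} {h' : Matrix (Fin n) (Fin n) ℝ} {s : Set ℝ} {t : ℝ}
    (hF : DifferentiableAt ℝ F (fun i j => ((h t).1 : Matrix (Fin n) (Fin n) ℝ) i j))
    (hh : HasDerivWithinAt (fun s => ((h s).1 : Matrix (Fin n) (Fin n) ℝ)) h' s t) :
    HasDerivWithinAt (fun s => F (fun i j => ((h s).1 : Matrix (Fin n) (Fin n) ℝ) i j))
      (fderiv ℝ F (fun i j => ((h t).1 : Matrix (Fin n) (Fin n) ℝ) i j) (fun i j => h' i j)) s t := by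
  have h1 : HasDerivWithinAt (fun s => (fun i j => ((h s).1 : Matrix (Fin n) (Fin n) ℝ) i j :
      Fin n → Fin n → ℝ)) (fun i j => h' i j) s t := hh
  exact hF.hasFDerivAt.comp_hasDerivWithinAt t h1

theorem hasDerivWithinAt_univ_matrix {A : ℝ → Matrix (Fin n) (Fin n) ℝ}
    {A' : Matrix (Fin n) (Fin n) ℝ} {t : ℝ} :
    HasDerivWithinAt A A' Set.univ t ↔ HasDerivAt A A' t :=
  hasDerivWithinAt_univ (F := Fin n → Fin n → ℝ)

/-- The differential at the neutral element of a function of the matrix entries. -/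
theorem diffAtOne_eq_fderiv {E : Type*} [NormedAddCommGroup E] [NormedSpace ℝ E] {φ : G → E}
    {F : (Fin n → Fin n → ℝ) → E}
    (hF : DifferentiableAt ℝ F (fun i j => (1 : Matrix (Fin n) (Fin n) ℝ) i j))
    (hφ : ∀ᶠ g in nhds (1 : G), φ g = F (fun i j => (g.1 : Matrix (Fin n) (Fin n) ℝ) i j))
    (X : lieAlg G) :
    diffAtOne φ X = fderiv ℝ F (fun i j => (1 : Matrix (Fin n) (Fin n) ℝ) i j)
      (fun i j => X.1 i j) := by
  have hγ : IsTangentCurve G (tangentCurve X) X.1 := Classical.choose_spec X.2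
  have h1 := hasDerivWithinAt_comp_entries (h := tangentCurve X) (t := 0) (s := Set.univ)
    (F := F) (by simpa [hγ.1] using hF) (hasDerivWithinAt_univ_matrix.mpr hγ.2)
  rw [hasDerivWithinAt_univ] at h1
  have h2 := h1.congr_of_eventuallyEq (hγ.tendsto.eventually hφ)
  rw [diffAtOne, h2.deriv, hγ.1]
  rfl

section rightTranslate

attribute [local instance] Matrix.linftyOpNormedRing Matrix.linftyOpNormedAlgebra

theorem hasDerivWithinAt_mul_const {A : ℝ → Matrix (Fin n) (Fin n) ℝ}
    {A' : Matrix (Fin n) (Fin n) ℝ} {s : Set ℝ} {t : ℝ} (h : HasDerivWithinAt A A' s t)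
    (C : Matrix (Fin n) (Fin n) ℝ) : HasDerivWithinAt (fun t => A t * C) (A' * C) s t :=
  h.mul_const C

theorem hasDerivWithinAt_const_mul {A : ℝ → Matrix (Fin n) (Fin n) ℝ}
    {A' : Matrix (Fin n) (Fin n) ℝ} {s : Set ℝ} {t : ℝ} (h : HasDerivWithinAt A A' s t)
    (C : Matrix (Fin n) (Fin n) ℝ) : HasDerivWithinAt (fun t => C * A t) (C * A') s t :=
  h.const_mul C

end rightTranslate

/-- Write `h(s) = (h(s)h(t)⁻¹) h(t)`. The first factor passes through `1` with velocity `X`, so only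
the differential at `1` of the orbit map of `ρ(h(t))v` is needed. -/
theorem IsAlgebraicRep.hasDerivWithinAt [NormedSpace ℝ V] [FiniteDimensional ℝ V]
    {ρ : Representation ℝ G V} (hρ : IsAlgebraicRep ρ) {h : ℝ → G} {X : lieAlg G} {s : Set ℝ}
    {t : ℝ} (hh : HasDerivWithinAt (fun s => ((h s).1 : Matrix (Fin n) (Fin n) ℝ))
      (X.1 * ((h t).1 : Matrix (Fin n) (Fin n) ℝ)) s t) (v : V) :
    HasDerivWithinAt (fun s => ρ (h s) v) (repDiff ρ X (ρ (h t) v)) s t := by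
  obtain ⟨F, hF, hφ⟩ := hρ.exists_contDiffAt (ρ (h t) v)
  have hF1 : DifferentiableAt ℝ F (fun i j => (1 : Matrix (Fin n) (Fin n) ℝ) i j) :=
    (hF _ (det_coe_ne_zero 1)).differentiableAt (by simp)
  have h1 : HasDerivWithinAt (fun s => ((h s * (h t)⁻¹).1 : Matrix (Fin n) (Fin n) ℝ)) X.1 s t := by
    have h2 := hasDerivWithinAt_mul_const hh (((h t)⁻¹).1 : Matrix (Fin n) (Fin n) ℝ)
    rw [mul_assoc] at h2
    have h3 : ((h t).1 : Matrix (Fin n) (Fin n) ℝ) * (((h t)⁻¹).1 : Matrix (Fin n) (Fin n) ℝ) = 1 :=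
      Units.mul_inv (h t).1
    rwa [h3, mul_one] at h2
  have h2 := hasDerivWithinAt_comp_entries (h := fun s => h s * (h t)⁻¹) (F := F)
    (by simpa using hF1) h1
  rw [repDiff, diffAtOne_eq_fderiv hF1 (Filter.Eventually.of_forall hφ)]
  simp only [mul_inv_cancel, ← hφ] at h2
  simpa [← Module.End.mul_apply, ← map_mul] using h2

/-- Linearity in `X` comes from the differential of a single orbit map; linearity in `v` comes from
differentiating along the same curve for all vectors. -/
theorem IsAlgebraicRep.exists_repDiff_eq [NormedSpace ℝ V] [FiniteDimensional ℝ V]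
    {ρ : Representation ℝ G V} (hρ : IsAlgebraicRep ρ) :
    ∃ π : lieAlg G →ₗ[ℝ] V →ₗ[ℝ] V, ∀ X v, repDiff ρ X v = π X v := by
  have hd : ∀ (X : lieAlg G) v,
      HasDerivAt (fun t => ρ (tangentCurve X t) v) (repDiff ρ X v) 0 := fun X v => by
    obtain ⟨D, hD, hD'⟩ := hρ.exists_diffAtOne v
    rw [repDiff, hD]
    exact hD' X _ (Classical.choose_spec X.2)
  refine ⟨LinearMap.mk₂ ℝ (repDiff ρ) (fun X Y v => ?_) (fun c X v => ?_) (fun X v w => ?_)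
    (fun c X v => ?_), fun X v => rfl⟩
  · obtain ⟨D, hD, -⟩ := hρ.exists_diffAtOne v
    simp only [repDiff, hD, map_add]
  · obtain ⟨D, hD, -⟩ := hρ.exists_diffAtOne v
    simp only [repDiff, hD, map_smul]
  · refine (hd X (v + w)).unique ?_
    simp only [map_add]
    exact (hd X v).add (hd X w)
  · refine (hd X (c • v)).unique ?_
    simp only [map_smul]
    exact (hd X v).const_smul c

/-- Differentiate `ρ(kγ(t)k⁻¹)ρ(k)v = ρ(k)ρ(γ(t))v` at `0`. -/
theorem IsAlgebraicRep.repDiff_Ad [NormedSpace ℝ V] [FiniteDimensional ℝ V]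
    {ρ : Representation ℝ G V} (hρ : IsAlgebraicRep ρ) (k : G) (X : lieAlg G) (v : V) :
    repDiff ρ (Ad k X) (ρ k v) = ρ k (repDiff ρ X v) := by
  have hγ : IsTangentCurve G (tangentCurve X) X.1 := Classical.choose_spec X.2
  obtain ⟨D, hD, hD'⟩ := hρ.exists_diffAtOne (ρ k v)
  obtain ⟨D₁, hD₁, hD₁'⟩ := hρ.exists_diffAtOne v
  have h1 := hD' (Ad k X) _ (hγ.conj k)
  have h2 := (LinearMap.toContinuousLinearMap (ρ k)).hasFDerivAt.comp_hasDerivAt (0 : ℝ)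
    (hD₁' X _ hγ)
  rw [repDiff, repDiff, hD, hD₁]
  refine h1.unique ?_
  convert! h2 using 1
  funext t
  simp [← Module.End.mul_apply, ← map_mul]

end smooth

/-! ### The action of `K` on the Cartan decomposition -/

section cartan

variable {n : ℕ}

theorem conj_mem_tangentSpace_of_normalizes {H : Subgroup (GL (Fin n) ℝ)} {g : GL (Fin n) ℝ}
    (hg : ∀ h ∈ H, g * h * g⁻¹ ∈ H) {X : Matrix (Fin n) (Fin n) ℝ} (hX : X ∈ tangentSpace H) :
    (g : Matrix (Fin n) (Fin n) ℝ) * X * ((g⁻¹ : GL (Fin n) ℝ) : Matrix (Fin n) (Fin n) ℝ) ∈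
      tangentSpace H := by
  obtain ⟨γ, h⟩ := hX
  refine ⟨fun t => ⟨g * (γ t).1 * g⁻¹, hg _ (γ t).2⟩, Subtype.ext (by simp [h.1]), ?_⟩
  exact hasDerivWithinAt_univ_matrix.mp (hasDerivWithinAt_mul_const
    (hasDerivWithinAt_const_mul (hasDerivWithinAt_univ_matrix.mpr h.2) _) _)

/-- The entries of `gxg⁻¹` are polynomials `f` in the entries of `x`; substituting them into the
equations of `L` gives equations of the preimage. -/
theorem IsLinearAlgebraic.comap_conj {L : Subgroup (GL (Fin n) ℝ)} (hL : IsLinearAlgebraic L)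
    (g : GL (Fin n) ℝ) : IsLinearAlgebraic (L.comap (MulAut.conj g).toMonoidHom) := by
  obtain ⟨S, hS⟩ := hL
  let f : Fin n × Fin n → MvPolynomial (Fin n × Fin n) ℝ := fun ij =>
    ∑ l, (∑ k, MvPolynomial.C ((g : Matrix (Fin n) (Fin n) ℝ) ij.1 k) * MvPolynomial.X (k, l)) *
      MvPolynomial.C (((g⁻¹ : GL (Fin n) ℝ) : Matrix (Fin n) (Fin n) ℝ) l ij.2)
  refine ⟨MvPolynomial.bind₁ f '' S, ?_⟩
  ext x
  have hx : x ∈ ((L.comap (MulAut.conj g).toMonoidHom : Subgroup (GL (Fin n) ℝ)) :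
      Set (GL (Fin n) ℝ)) ↔ g * x * g⁻¹ ∈ (L : Set (GL (Fin n) ℝ)) := Iff.rfl
  rw [hx, hS]
  simp only [Set.mem_ofPred_eq, Set.forall_mem_image]
  refine forall₂_congr fun p _ => ?_
  rw [MvPolynomial.hom_bind₁]
  have h1 : (fun ij : Fin n × Fin n => MvPolynomial.eval
      (fun ij => (x : Matrix (Fin n) (Fin n) ℝ) ij.1 ij.2) (f ij)) =
      fun ij => ((g * x * g⁻¹ : GL (Fin n) ℝ) : Matrix (Fin n) (Fin n) ℝ) ij.1 ij.2 := by
    funext ij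
    simp [f, Matrix.mul_apply]
  rw [← h1]
  change _ ↔ MvPolynomial.eval₂ _ _ _ = _
  rw [MvPolynomial.eval, MvPolynomial.coe_eval₂Hom]
  congr! 2
  ext
  simp

/-- The conjugation preimage of an algebraic group containing `⁅G, G⁆` is another such group, so it
also contains the infimum. -/
theorem conj_mem_derivedGroup {G : Subgroup (GL (Fin n) ℝ)} {g : GL (Fin n) ℝ} (hg : g ∈ G) :
    ∀ h ∈ derivedGroup G, g * h * g⁻¹ ∈ derivedGroup G := by
  intro h hh
  refine Subgroup.mem_sInf.mpr fun L hL => ?_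
  refine Subgroup.mem_sInf.mp hh (L.comap (MulAut.conj g).toMonoidHom)
    ⟨hL.1.comap_conj g, Subgroup.commutator_le.mpr fun a ha b hb => ?_⟩
  have h1 := hL.2 (Subgroup.commutator_mem_commutator
    (G.mul_mem (G.mul_mem hg ha) (G.inv_mem hg)) (G.mul_mem (G.mul_mem hg hb) (G.inv_mem hg)))
  change g * (a * b * a⁻¹ * b⁻¹) * g⁻¹ ∈ L
  convert! h1 using 1
  change g * (a * b * a⁻¹ * b⁻¹) * g⁻¹ =
    g * a * g⁻¹ * (g * b * g⁻¹) * (g * a * g⁻¹)⁻¹ * (g * b * g⁻¹)⁻¹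
  group

/-- Conjugation by an element that normalizes `H`, as an automorphism of the Lie algebra. -/
def conjLieEquiv {H : Subgroup (GL (Fin n) ℝ)} (g : GL (Fin n) ℝ)
    (hg : ∀ h ∈ H, g * h * g⁻¹ ∈ H) (hg' : ∀ h ∈ H, g⁻¹ * h * g ∈ H) :
    lieAlg H ≃ₗ⁅ℝ⁆ lieAlg H where
  toFun X := ⟨(g : Matrix (Fin n) (Fin n) ℝ) * X.1 *
    ((g⁻¹ : GL (Fin n) ℝ) : Matrix (Fin n) (Fin n) ℝ), conj_mem_tangentSpace_of_normalizes hg X.2⟩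
  invFun X := ⟨((g⁻¹ : GL (Fin n) ℝ) : Matrix (Fin n) (Fin n) ℝ) * X.1 *
    (g : Matrix (Fin n) (Fin n) ℝ), by
      simpa using! conj_mem_tangentSpace_of_normalizes (g := g⁻¹) (by simpa using hg') X.2⟩
  map_add' X Y := Subtype.ext (by simp [mul_add, add_mul])
  map_smul' c X := Subtype.ext (by simp)
  map_lie' {X Y} := Subtype.ext (by
    have e : ((g⁻¹ : GL (Fin n) ℝ) : Matrix (Fin n) (Fin n) ℝ) * (g : Matrix (Fin n) (Fin n) ℝ) = 1 :=
      Units.inv_mul g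
    have e' : ∀ Z : Matrix (Fin n) (Fin n) ℝ, ((g⁻¹ : GL (Fin n) ℝ) : Matrix (Fin n) (Fin n) ℝ) *
        ((g : Matrix (Fin n) (Fin n) ℝ) * Z) = Z := fun Z => by rw [← mul_assoc, e, one_mul]
    simp only [LieSubalgebra.coe_bracket, Ring.lie_def, mul_sub, sub_mul, mul_assoc, e'])
  left_inv X := Subtype.ext (by
    have e : ((g⁻¹ : GL (Fin n) ℝ) : Matrix (Fin n) (Fin n) ℝ) * (g : Matrix (Fin n) (Fin n) ℝ) = 1 :=
      Units.inv_mul g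
    simp only [mul_assoc, e, mul_one]
    rw [← mul_assoc, e, one_mul])
  right_inv X := Subtype.ext (by
    have e : (g : Matrix (Fin n) (Fin n) ℝ) * ((g⁻¹ : GL (Fin n) ℝ) : Matrix (Fin n) (Fin n) ℝ) = 1 :=
      Units.mul_inv g
    simp only [mul_assoc, e, mul_one]
    rw [← mul_assoc, e, one_mul])

variable {G K : Subgroup (GL (Fin n) ℝ)}

/-- Conjugation by `k` is an automorphism of `Lie G^der`, so it preserves the Killing form; it also
preserves `Lie K`, hence the orthogonal complement. -/
theorem conj_mem_cartanPDer (hKG : K ≤ G) {k : GL (Fin n) ℝ} (hk : k ∈ K)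
    {X : Matrix (Fin n) (Fin n) ℝ} (hX : X ∈ cartanPDer G K) :
    (k : Matrix (Fin n) (Fin n) ℝ) * X * ((k⁻¹ : GL (Fin n) ℝ) : Matrix (Fin n) (Fin n) ℝ) ∈
      cartanPDer G K := by
  obtain ⟨X, hX, rfl⟩ := hX
  have hn := conj_mem_derivedGroup (hKG hk)
  have hn' := conj_mem_derivedGroup (G.inv_mem (hKG hk))
  simp only [inv_inv] at hn'
  let e := conjLieEquiv k hn hn'
  refine ⟨e X, fun Y hY => ?_, rfl⟩
  rw [← e.apply_symm_apply Y, LieAlgebra.killingForm_of_equiv_apply]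
  refine hX _ ?_
  have := conj_mem_tangentSpace_of_normalizes (g := k⁻¹) (H := K)
    (fun h hh => by simpa using K.mul_mem (K.mul_mem (K.inv_mem hk) hh) hk) hY
  rw [inv_inv] at this
  exact this

theorem maxSplitCentralTorus_le : maxSplitCentralTorus G ≤ centerGL G :=
  sSup_le fun _ h => h.2

/-- On the second summand, conjugation by `k` fixes the split torus pointwise because the torus is
central. -/
theorem Ad_mem_cartanP (hKG : K ≤ G) {k : G} (hk : k.1 ∈ K) {X : lieAlg G}
    (hX : X ∈ cartanP G K) : Ad k X ∈ cartanP G K := by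
  obtain ⟨Y, hY, Z, hZ, hYZ⟩ := Submodule.mem_sup.mp hX
  refine Submodule.mem_sup.mpr ⟨_, conj_mem_cartanPDer hKG hk hY, _,
    conj_mem_tangentSpace_of_normalizes (g := k.1) (fun h hh => ?_) hZ, ?_⟩
  · obtain ⟨c, hc, rfl⟩ := maxSplitCentralTorus_le hh
    have h1 : k * c = c * k := (Subgroup.mem_center_iff.mp hc k)
    have h2 : k.1 * (G.subtype c) * k.1⁻¹ = G.subtype c := by
      have := congrArg Subtype.val h1
      simp only [Subgroup.coe_mul] at this
      rw [Subgroup.coe_subtype, this, mul_inv_cancel_right]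
    rw [h2]
    exact hh
  · change _ = (k.1 : Matrix (Fin n) (Fin n) ℝ) * X.1 * ((k⁻¹).1 : Matrix (Fin n) (Fin n) ℝ)
    rw [← add_mul, ← mul_add, hYZ]
    rfl

end cartan

/-! ### The moment map -/

section moment

variable {n : ℕ} {G K : Subgroup (GL (Fin n) ℝ)} {B : LinearMap.BilinForm ℝ (lieAlg G)}
  {V : Type*} [NormedAddCommGroup V] [InnerProductSpace ℝ V]
  {ρ : Representation ℝ G V}

theorem momentMapTranslate_inv (h : G) (v : V) :
    momentMapTranslate G K B ρ h⁻¹ v = Ad h⁻¹ (momentMap G K B ρ (ρ h v)) := by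
  rw [momentMapTranslate, inv_inv]

/-- Turns `h' = -h · m^{h⁻¹·ḡ}(v̄)` into `h' = -m(ρ(h)v̄) h`, whose coefficient depends only on the
point `ρ(h)v̄`. -/
theorem mul_momentMapTranslate_inv (h : G) (v : V) :
    (h.1 : Matrix (Fin n) (Fin n) ℝ) * (momentMapTranslate G K B ρ h⁻¹ v).1 =
      (momentMap G K B ρ (ρ h v)).1 * (h.1 : Matrix (Fin n) (Fin n) ℝ) := by
  have e : (h.1 : Matrix (Fin n) (Fin n) ℝ) * ((h⁻¹).1 : Matrix (Fin n) (Fin n) ℝ) = 1 :=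
    Units.mul_inv h.1
  rw [momentMapTranslate_inv]
  change (h.1 : Matrix (Fin n) (Fin n) ℝ) * (((h⁻¹).1 : Matrix (Fin n) (Fin n) ℝ) * _ *
    ((h⁻¹⁻¹).1 : Matrix (Fin n) (Fin n) ℝ)) = _
  rw [inv_inv, ← mul_assoc, ← mul_assoc, e, one_mul]

variable [FiniteDimensional ℝ V]

theorem isMomentAt_momentMap (hB : IsLieScalarProduct G K B) (hρ : IsAlgebraicRep ρ) (v : V) :
    IsMomentAt G K B ρ v (momentMap G K B ρ v) :=
  Classical.epsilon_spec (existsUnique_isMomentAt hB hρ v).exists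

theorem IsMomentAt.eq_momentMap (hB : IsLieScalarProduct G K B) (hρ : IsAlgebraicRep ρ) {v : V}
    {Y : lieAlg G} (hY : IsMomentAt G K B ρ v Y) : Y = momentMap G K B ρ v :=
  (existsUnique_isMomentAt hB hρ v).unique hY (isMomentAt_momentMap hB hρ v)

/-- Take for `e` a basis of `𝔭` and for `f` its `B`-dual basis. The explicit formula reduces
regularity of `m` to that of quotients of quadratic forms. -/
theorem exists_momentMap_eq_sum (hB : IsLieScalarProduct G K B) (hρ : IsAlgebraicRep ρ) :
    ∃ (r : ℕ) (e f : Fin r → lieAlg G), ∀ v, momentMap G K B ρ v =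
      ∑ i, (inner ℝ (repDiff ρ (e i) v) v / inner ℝ v v) • f i := by
  obtain ⟨π, hπ⟩ := hρ.exists_repDiff_eq
  let BP : LinearMap.BilinForm ℝ (cartanP G K) := B.restrict (cartanP G K)
  have hpos : ∀ X : cartanP G K, BP X X = 0 → X = 0 := fun X hX => by
    by_contra hne
    exact (hB.pos X.1 fun h => hne (Subtype.ext h)).ne' hX
  have hBP : BP.Nondegenerate := ⟨fun X hX => hpos X (hX X), fun X hX => hpos X (hX X)⟩
  let b := Module.finBasis ℝ (cartanP G K)
  let d := BP.dualBasis hBP b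
  refine ⟨_, fun i => (b i).1, fun i => (d i).1, fun v => Eq.symm ?_⟩
  refine IsMomentAt.eq_momentMap hB hρ
    ⟨Submodule.sum_mem _ fun i _ => Submodule.smul_mem _ _ (d i).2, fun X hX => ?_⟩
  have hd : ∀ i, B (d i).1 X = b.repr ⟨X, hX⟩ i := fun i => by
    have h1 : BP (d i) ⟨X, hX⟩ = b.repr ⟨X, hX⟩ i := by
      conv_lhs => rw [← b.sum_repr ⟨X, hX⟩]
      simp only [map_sum, map_smul, smul_eq_mul]
      rw [Finset.sum_eq_single i]
      · rw [LinearMap.BilinForm.apply_dualBasis_left]; simp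
      · intro j _ hj
        rw [LinearMap.BilinForm.apply_dualBasis_left]; simp [hj]
      · simp
    exact h1
  have hX' : X = ∑ i, b.repr ⟨X, hX⟩ i • (b i).1 := by
    have h1 := congrArg Subtype.val (b.sum_repr ⟨X, hX⟩)
    rw [Submodule.coe_sum] at h1
    exact h1.symm
  conv_rhs => rw [hX', hπ]
  simp only [map_sum, map_smul, LinearMap.sum_apply, LinearMap.smul_apply, smul_eq_mul, hd,
    sum_inner, real_inner_smul_left, Finset.sum_div, hπ]
  exact Finset.sum_congr rfl fun i _ => by ring

theorem contDiffAt_momentMap (hB : IsLieScalarProduct G K B) (hρ : IsAlgebraicRep ρ) (i j : Fin n)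
    {v : V} (hv : v ≠ 0) :
    ContDiffAt ℝ (⊤ : ℕ∞) (fun v => (momentMap G K B ρ v).1 i j) v := by
  obtain ⟨r, e, f, hm⟩ := exists_momentMap_eq_sum hB hρ
  obtain ⟨π, hπ⟩ := hρ.exists_repDiff_eq
  have h1 : ∀ v, (momentMap G K B ρ v).1 i j =
      ∑ k, (inner ℝ (LinearMap.toContinuousLinearMap (π (e k)) v) v / inner ℝ v v) *
        (f k).1 i j := fun v => by
    rw [hm v]
    change ((lieAlg G).toSubmodule.subtype (∑ k, _)) i j = _
    simp [map_sum, Matrix.sum_apply, hπ]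
  simp only [h1]
  refine ContDiffAt.sum fun k _ => ContDiffAt.mul (ContDiffAt.div ?_ ?_ ?_) contDiffAt_const
  · exact (ContinuousLinearMap.contDiff _).contDiffAt.inner ℝ contDiffAt_id
  · exact contDiffAt_id.inner ℝ contDiffAt_id
  · exact inner_self_ne_zero.mpr hv

theorem contDiffAt_repDiff_momentMap (hB : IsLieScalarProduct G K B) (hρ : IsAlgebraicRep ρ)
    {v : V} (hv : v ≠ 0) :
    ContDiffAt ℝ 1 (fun v => -repDiff ρ (momentMap G K B ρ v) v) v := by
  obtain ⟨r, e, f, hm⟩ := exists_momentMap_eq_sum hB hρ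
  obtain ⟨π, hπ⟩ := hρ.exists_repDiff_eq
  have h1 : ∀ v, repDiff ρ (momentMap G K B ρ v) v =
      ∑ k, (inner ℝ (LinearMap.toContinuousLinearMap (π (e k)) v) v / inner ℝ v v) •
        LinearMap.toContinuousLinearMap (π (f k)) v := fun v => by
    rw [hm v, hπ]
    simp [map_sum, hπ]
  simp only [h1]
  refine (ContDiffAt.sum fun k _ => ContDiffAt.smul (ContDiffAt.div ?_ ?_ ?_) ?_).neg
  · exact (ContinuousLinearMap.contDiff _).contDiffAt.inner ℝ contDiffAt_id
  · exact contDiffAt_id.inner ℝ contDiffAt_id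
  · exact inner_self_ne_zero.mpr hv
  · exact (ContinuousLinearMap.contDiff _).contDiffAt

/-- `Ad_k m(v)` has the defining property of `m(ρ(k)v)`: `Ad_k` preserves `𝔭` and `B`, and `ρ(k)` is
orthogonal. -/
theorem momentMap_smul_eq (hKG : K ≤ G) (hB : IsLieScalarProduct G K B) (hρ : IsAlgebraicRep ρ)
    (hV : IsAdapted G K ρ) {k : G} (hk : k.1 ∈ K) (v : V) :
    momentMap G K B ρ (ρ k v) = Ad k (momentMap G K B ρ v) := by
  obtain ⟨hm, hm'⟩ := isMomentAt_momentMap hB hρ v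
  have hAd : ∀ X : lieAlg G, Ad k (Ad k⁻¹ X) = X := fun X => Subtype.ext (by
    have e : (k.1 : Matrix (Fin n) (Fin n) ℝ) * ((k⁻¹).1 : Matrix (Fin n) (Fin n) ℝ) = 1 :=
      Units.mul_inv k.1
    change (k.1 : Matrix (Fin n) (Fin n) ℝ) * (((k⁻¹).1 : Matrix (Fin n) (Fin n) ℝ) * X.1 *
      ((k⁻¹⁻¹).1 : Matrix (Fin n) (Fin n) ℝ)) * ((k⁻¹).1 : Matrix (Fin n) (Fin n) ℝ) = X.1
    rw [inv_inv, mul_assoc, mul_assoc, e, mul_one, ← mul_assoc, e, one_mul])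
  refine (IsMomentAt.eq_momentMap hB hρ ⟨Ad_mem_cartanP hKG hk hm, fun X hX => ?_⟩).symm
  have hX' : Ad k⁻¹ X ∈ cartanP G K := Ad_mem_cartanP hKG (K.inv_mem hk) hX
  rw [hV.orthogonal k hk]
  conv_lhs => rw [← hAd X]
  rw [hB.ad_invariant k hk, hm' _ hX']
  conv_rhs => rw [← hAd X, hρ.repDiff_Ad, hV.orthogonal k hk]

/-- For `h' = kh`, equivariance produces a factor `Ad_k` that cancels against the `Ad_{k⁻¹}`
contained in `Ad_{h'⁻¹}`. -/
theorem momentMapTranslate_inv_congr (hKG : K ≤ G) (hB : IsLieScalarProduct G K B)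
    (hρ : IsAlgebraicRep ρ) (hV : IsAdapted G K ρ) {h h' : G} (hh : coset K h = coset K h')
    (v : V) : momentMapTranslate G K B ρ h⁻¹ v = momentMapTranslate G K B ρ h'⁻¹ v := by
  have hk : h' * h⁻¹ ∈ K.subgroupOf G := QuotientGroup.rightRel_apply.mp (Quotient.exact hh)
  obtain ⟨k, rfl⟩ : ∃ k, h' = k * h := ⟨h' * h⁻¹, by simp⟩
  rw [mul_inv_cancel_right] at hk
  rw [momentMapTranslate_inv, momentMapTranslate_inv, map_mul, Module.End.mul_apply,
    momentMap_smul_eq hKG hB hρ hV hk]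
  refine Subtype.ext ?_
  have e : ((k⁻¹).1 : Matrix (Fin n) (Fin n) ℝ) * (k.1 : Matrix (Fin n) (Fin n) ℝ) = 1 :=
    Units.inv_mul k.1
  have e' : ∀ Z : Matrix (Fin n) (Fin n) ℝ, ((k⁻¹).1 : Matrix (Fin n) (Fin n) ℝ) *
      ((k.1 : Matrix (Fin n) (Fin n) ℝ) * Z) = Z := fun Z => by rw [← mul_assoc, e, one_mul]
  simp only [Ad, mul_inv_rev, inv_inv, Subgroup.coe_mul, Units.val_mul, mul_assoc, e']

end moment

/-! ### Curves on `[0,T)` -/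

section curves

open Set

/-- Derivatives within `[0,T)` ignore values outside it, so curves on the subtype can be treated as
restrictions of curves on `ℝ`. -/
theorem hasDerivIco_iff {E : Type*} [NormedAddCommGroup E] [NormedSpace ℝ E] {T : ℝ} {u : ℝ → E} {u' : E} {t : Ico 0 T} :
    HasDerivIco (fun s : Ico 0 T => u s) u' t ↔ HasDerivWithinAt u u' (Ico 0 T) t.1 := by
  have h : ∀ s ∈ Ico 0 T, Function.extend Subtype.val (fun s : Ico 0 T => u s) 0 s = u s :=
    fun s hs => Subtype.val_injective.extend_apply (fun s : Ico 0 T => u s) 0 ⟨s, hs⟩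
  exact ⟨fun hd => hd.congr (fun s hs => (h s hs).symm) (h _ t.2).symm,
    fun hd => hd.congr h (h _ t.2)⟩

theorem hasDerivIco_matrix_iff {n : ℕ} {T : ℝ} {u : ℝ → Matrix (Fin n) (Fin n) ℝ}
    {u' : Matrix (Fin n) (Fin n) ℝ} {t : Ico 0 T} :
    HasDerivIco (fun s : Ico 0 T => u s) u' t ↔ HasDerivWithinAt u u' (Ico 0 T) t.1 :=
  hasDerivIco_iff (E := Fin n → Fin n → ℝ)

theorem exists_eq_restrict {α : Type*} [Nonempty α] {T : ℝ} (u : Ico 0 T → α) :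
    ∃ U : ℝ → α, u = fun t : Ico 0 T => U t :=
  ⟨Function.extend Subtype.val u fun _ => Classical.arbitrary α, funext fun t =>
    (Subtype.val_injective.extend_apply u _ t).symm⟩

end curves

/-! ### Relations between the flows -/

section flows

open Set

variable {n : ℕ} {G K : Subgroup (GL (Fin n) ℝ)} {B : LinearMap.BilinForm ℝ (lieAlg G)}
  {V : Type*} [NormedAddCommGroup V] [InnerProductSpace ℝ V]
  {ρ : Representation ℝ G V} {T : ℝ}

theorem isGradientFlow_iff {v₀ : V} (hT : 0 < T) {v : ℝ → V} :
    IsGradientFlow G K B ρ v₀ hT (fun t : Ico 0 T => v t) ↔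
      (∀ t ∈ Ico 0 T, v t ≠ 0) ∧ v 0 = v₀ ∧ ∀ t ∈ Ico 0 T,
        HasDerivWithinAt v (-repDiff ρ (momentMap G K B ρ (v t)) (v t)) (Ico 0 T) t := by
  simp only [IsGradientFlow, hasDerivIco_iff, Subtype.forall]

theorem isLiftedFlow_iff {vbar : V} {h₀ : G} (hT : 0 < T) {h : ℝ → G} :
    IsLiftedFlow G K B ρ vbar h₀ hT (fun t : Ico 0 T => h t) ↔
      h 0 = h₀ ∧ ∀ t ∈ Ico 0 T,
        HasDerivWithinAt (fun s => ((h s).1 : Matrix (Fin n) (Fin n) ℝ))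
          ((-momentMap G K B ρ (ρ (h t) vbar)).1 * ((h t).1 : Matrix (Fin n) (Fin n) ℝ))
          (Ico 0 T) t := by
  simp only [IsLiftedFlow, mul_momentMapTranslate_inv]
  refine and_congr_right fun _ => ?_
  rw [Subtype.forall]
  refine forall₂_congr fun t ht => ?_
  rw [hasDerivIco_matrix_iff (u := fun s => ((h s).1 : Matrix (Fin n) (Fin n) ℝ)),
    ← neg_mul]
  rfl

section embedding

attribute [local instance] Matrix.linftyOpNormedRing Matrix.linftyOpNormedAlgebra

theorem isOpenEmbedding_val_GL :
    Topology.IsOpenEmbedding (Units.val : GL (Fin n) ℝ → Matrix (Fin n) (Fin n) ℝ) :=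
  have : CompleteSpace (Matrix (Fin n) (Fin n) ℝ) := FiniteDimensional.complete ℝ _
  Units.isOpenEmbedding_val

end embedding

theorem tendsto_of_matrix {h : ℝ → G} {s : Set ℝ} {t : ℝ} {h' : Matrix (Fin n) (Fin n) ℝ}
    (hh : HasDerivWithinAt (fun s => ((h s).1 : Matrix (Fin n) (Fin n) ℝ)) h' s t) :
    Filter.Tendsto h (nhdsWithin t s) (nhds (h t)) := by
  rw [tendsto_subtype_rng]
  refine isOpenEmbedding_val_GL.isEmbedding.tendsto_nhds_iff.mpr ?_
  exact HasDerivWithinAt.continuousWithinAt (F := Fin n → Fin n → ℝ) hh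

/-- The differential of `g ↦ f(Khg)` in terms of a local extension of `f` to matrices. -/
theorem leftTranslateDiff_coset {f : LeftQuot G K → ℝ} {g : G} {F : (Fin n → Fin n → ℝ) → ℝ}
    (hF : DifferentiableAt ℝ F (fun i j => (g.1 : Matrix (Fin n) (Fin n) ℝ) i j))
    (hf : ∀ᶠ g' in nhds g,
      f (coset K g') = F (fun i j => (g'.1 : Matrix (Fin n) (Fin n) ℝ) i j))
    (X : lieAlg G) :
    leftTranslateDiff (coset K g) X f = fderiv ℝ F
      (fun i j => (g.1 : Matrix (Fin n) (Fin n) ℝ) i j)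
      (fun i j => ((g.1 : Matrix (Fin n) (Fin n) ℝ) * X.1) i j) := by
  -- Left multiplication by `g` on matrices: if `F` extends `f` near `g`, then `F ∘ L` extends `g' ↦
  -- f(Kgg')` near `1`.
  let L : (Fin n → Fin n → ℝ) →L[ℝ] (Fin n → Fin n → ℝ) := LinearMap.toContinuousLinearMap
    { toFun := fun A i j => ((g.1 : Matrix (Fin n) (Fin n) ℝ) * Matrix.of A) i j
      map_add' := fun A A' => by
        funext i j
        change ((g.1 : Matrix (Fin n) (Fin n) ℝ) * (Matrix.of A + Matrix.of A')) i j = _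
        rw [mul_add]
        rfl
      map_smul' := fun c A => by
        funext i j
        change ((g.1 : Matrix (Fin n) (Fin n) ℝ) * (c • Matrix.of A)) i j = _
        rw [mul_smul_comm]
        rfl }
  have hL : ∀ A : Matrix (Fin n) (Fin n) ℝ, L (fun i j => A i j) =
      fun i j => ((g.1 : Matrix (Fin n) (Fin n) ℝ) * A) i j := fun A => rfl
  have hL1 : L (fun i j => (1 : Matrix (Fin n) (Fin n) ℝ) i j) =
      fun i j => (g.1 : Matrix (Fin n) (Fin n) ℝ) i j := by rw [hL, mul_one]
  have hF' : HasFDerivAt (fun A => F (L A))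
      ((fderiv ℝ F (fun i j => (g.1 : Matrix (Fin n) (Fin n) ℝ) i j)).comp L)
      (fun i j => (1 : Matrix (Fin n) (Fin n) ℝ) i j) := by
    refine HasFDerivAt.comp _ ?_ L.hasFDerivAt
    rw [hL1]
    exact hF.hasFDerivAt
  have hc : Filter.Tendsto (fun g' : G => g * g') (nhds 1) (nhds g) := by
    have : Continuous fun g' : G => g * g' := continuous_const.mul continuous_id
    simpa using this.tendsto 1
  have := diffAtOne_eq_fderiv (φ := fun g' => f (leftTranslate (coset K g) g'))
    hF'.differentiableAt (by filter_upwards [hc.eventually hf] with g' hg'; exact hg') X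
  rw [leftTranslateDiff, this, hF'.fderiv, ContinuousLinearMap.comp_apply, hL]

/-- Both sides are the derivative at `h(t)`, in direction `-h(t)X`, of a local extension of `f` to
matrices. -/
theorem hasDerivWithinAt_coset {f : LeftQuot G K → ℝ} (hf : IsSmoothOnQuot f) {h : ℝ → G}
    {X : lieAlg G} {s : Set ℝ} {t : ℝ}
    (hh : HasDerivWithinAt (fun s => ((h s).1 : Matrix (Fin n) (Fin n) ℝ))
      (-(((h t).1 : Matrix (Fin n) (Fin n) ℝ) * X.1)) s t) (ht : t ∈ s) :
    HasDerivWithinAt (fun s => f (coset K (h s))) (-leftTranslateDiff (coset K (h t)) X f) s t := by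
  obtain ⟨F, hF, hfF⟩ := hf (h t)
  have hF1 := hF.differentiableAt (by simp)
  rw [leftTranslateDiff_coset hF1 hfF]
  have h1 := hasDerivWithinAt_comp_entries hF1 hh
  have h2 := h1.congr_of_eventuallyEq_of_mem ((tendsto_of_matrix hh).eventually hfF) ht
  convert! h2 using 1
  rw [← map_neg]
  rfl

theorem coset_isMomentMapFlow [FiniteDimensional ℝ V] (hKG : K ≤ G)
    (hB : IsLieScalarProduct G K B) (hρ : IsAlgebraicRep ρ) (hV : IsAdapted G K ρ) {vbar : V}
    {h₀ : G} (hT : 0 < T) {h : Ico 0 T → G} (hh : IsLiftedFlow G K B ρ vbar h₀ hT h) :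
    IsMomentMapFlow G K B ρ vbar (coset K h₀) hT (fun t => coset K (h t)) := by
  obtain ⟨h, rfl⟩ := exists_eq_restrict h
  refine ⟨congrArg (coset K) hh.1, fun t g hg f hf => ?_⟩
  rw [momentMapTranslate_inv_congr hKG hB hρ hV hg]
  exact (hasDerivIco_iff (u := fun s => f (coset K (h s)))).mpr
    (hasDerivWithinAt_coset hf ((hasDerivIco_matrix_iff
      (u := fun s => ((h s).1 : Matrix (Fin n) (Fin n) ℝ))).mp (hh.2 t)) t.2)

theorem orbit_isGradientFlow [FiniteDimensional ℝ V] (hρ : IsAlgebraicRep ρ) {vbar : V}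
    (hv : vbar ≠ 0) {h₀ : G} (hT : 0 < T) {h : Ico 0 T → G}
    (hh : IsLiftedFlow G K B ρ vbar h₀ hT h) :
    IsGradientFlow G K B ρ (ρ h₀ vbar) hT (fun t => ρ (h t) vbar) := by
  obtain ⟨h, rfl⟩ := exists_eq_restrict h
  rw [isLiftedFlow_iff] at hh
  obtain ⟨π, hπ⟩ := hρ.exists_repDiff_eq
  refine (isGradientFlow_iff hT (v := fun t => ρ (h t) vbar)).mpr
    ⟨fun t _ h0 => hv ?_, by simp only [hh.1], fun t ht => ?_⟩
  · have := congrArg (ρ (h t)⁻¹) h0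
    simpa [← Module.End.mul_apply, ← map_mul] using this
  · have := hρ.hasDerivWithinAt (hh.2 t ht) vbar
    simpa [hπ] using this

/-- The field is `C¹` off `0`, hence locally Lipschitz there. The two trajectories over `[0,t]` form
a compact set avoiding `0`, on which it is therefore Lipschitz, and the standard uniqueness theorem
applies. -/
theorem gradientFlow_unique [FiniteDimensional ℝ V] (hB : IsLieScalarProduct G K B)
    (hρ : IsAlgebraicRep ρ) {v₀ : V} (hT : 0 < T) {v w : Ico 0 T → V}
    (hv : IsGradientFlow G K B ρ v₀ hT v) (hw : IsGradientFlow G K B ρ v₀ hT w) : v = w := by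
  obtain ⟨v, rfl⟩ := exists_eq_restrict v
  obtain ⟨w, rfl⟩ := exists_eq_restrict w
  rw [isGradientFlow_iff] at hv hw
  obtain ⟨hv, hv0, hvd⟩ := hv
  obtain ⟨hw, hw0, hwd⟩ := hw
  funext ⟨t, ht⟩
  have hsub : Icc 0 t ⊆ Ico 0 T := fun s hs => ⟨hs.1, hs.2.trans_lt ht.2⟩
  have hvc : ContinuousOn v (Icc 0 t) := fun s hs =>
    (hvd s (hsub hs)).continuousWithinAt.mono hsub
  have hwc : ContinuousOn w (Icc 0 t) := fun s hs =>
    (hwd s (hsub hs)).continuousWithinAt.mono hsub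
  have hcpt : IsCompact (v '' Icc 0 t ∪ w '' Icc 0 t) :=
    (isCompact_Icc.image_of_continuousOn hvc).union (isCompact_Icc.image_of_continuousOn hwc)
  have hne : ∀ x ∈ v '' Icc 0 t ∪ w '' Icc 0 t, x ≠ 0 := by
    rintro x (⟨s, hs, rfl⟩ | ⟨s, hs, rfl⟩)
    exacts [hv s (hsub hs), hw s (hsub hs)]
  obtain ⟨C, hC⟩ := LocallyLipschitzOn.exists_lipschitzOnWith_of_compact
    (f := fun x => -repDiff ρ (momentMap G K B ρ x) x) hcpt (fun x hx => by
      obtain ⟨C, U, hU, hC⟩ := (contDiffAt_repDiff_momentMap hB hρ (hne x hx)).exists_lipschitzOnWith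
      exact ⟨C, U, mem_nhdsWithin_of_mem_nhds hU, hC⟩)
  have hmono : ∀ s ∈ Ico 0 t, Ico 0 T ∈ nhdsWithin s (Ici s) := fun s hs =>
    Filter.mem_of_superset (Ico_mem_nhdsGE (hsub (Ico_subset_Icc_self hs)).2)
      (Ico_subset_Ico_left hs.1)
  exact ODE_solution_unique_of_mem_Icc_right (s := fun _ => v '' Icc 0 t ∪ w '' Icc 0 t)
    (v := fun _ x => -repDiff ρ (momentMap G K B ρ x) x) (fun _ _ => hC) hvc
    (fun s hs => (hvd s (hsub (Ico_subset_Icc_self hs))).mono_of_mem_nhdsWithin (hmono s hs))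
    (fun s hs => .inl ⟨s, Ico_subset_Icc_self hs, rfl⟩) hwc
    (fun s hs => (hwd s (hsub (Ico_subset_Icc_self hs))).mono_of_mem_nhdsWithin (hmono s hs))
    (fun s hs => .inr ⟨s, Ico_subset_Icc_self hs, rfl⟩) (hv0.trans hw0.symm) ⟨ht.1, le_rfl⟩

theorem continuousOn_neg_momentMap [FiniteDimensional ℝ V] (hB : IsLieScalarProduct G K B)
    (hρ : IsAlgebraicRep ρ) {v : ℝ → V} {s : Set ℝ} (hv : ContinuousOn v s)
    (hv0 : ∀ t ∈ s, v t ≠ 0) :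
    ContinuousOn (fun t => (-momentMap G K B ρ (v t)).1) s := by
  refine continuousOn_pi.mpr fun i => continuousOn_pi.mpr fun j t ht => ?_
  exact ((contDiffAt_momentMap hB hρ i j (hv0 t ht)).continuousAt.comp_continuousWithinAt
    (hv t ht)).neg

/-! ### Lifting the gradient flow to `G`. -/

section lift

attribute [local instance] Matrix.linftyOpNormedRing Matrix.linftyOpNormedAlgebra

/-- Solve `h' = -m(v(t)) h` with `v` given; this is linear in `h`. It becomes the lifted equation
once `v = ρ(h)v̄` is known. -/
theorem exists_liftedFlow [FiniteDimensional ℝ V] (hG : IsLinearAlgebraic G)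
    (hB : IsLieScalarProduct G K B) (hρ : IsAlgebraicRep ρ) {vbar : V} {h₀ : G} (hT : 0 < T)
    {v : Ico 0 T → V} (hv : IsGradientFlow G K B ρ (ρ h₀ vbar) hT v) :
    ∃ h : Ico 0 T → G, IsLiftedFlow G K B ρ vbar h₀ hT h ∧ ∀ t, v t = ρ (h t) vbar := by
  obtain ⟨v, rfl⟩ := exists_eq_restrict v
  rw [isGradientFlow_iff] at hv
  obtain ⟨hv, hv0, hvd⟩ := hv
  have hvc : ContinuousOn v (Ico 0 T) := fun t ht => (hvd t ht).continuousWithinAt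
  obtain ⟨h, hh0, hh⟩ := exists_groupFlow hG (continuousOn_neg_momentMap hB hρ hvc hv)
    (fun t _ => (-momentMap G K B ρ (v t)).2) h₀
  obtain ⟨π, hπ⟩ := hρ.exists_repDiff_eq
  obtain ⟨r, e, f, hm⟩ := exists_momentMap_eq_sum hB hρ
  let q : Fin r → ℝ → ℝ := fun i t => inner ℝ (repDiff ρ (e i) (v t)) (v t) / inner ℝ (v t) (v t)
  have hq : ∀ i, ContinuousOn (q i) (Ico 0 T) := fun i => by
    have h1 : ContinuousOn (fun t => repDiff ρ (e i) (v t)) (Ico 0 T) := by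
      simp only [hπ]
      exact (LinearMap.continuous_of_finiteDimensional (π (e i))).comp_continuousOn hvc
    exact (h1.inner hvc).div (hvc.inner hvc) fun t ht => inner_self_ne_zero.mpr (hv t ht)
  let L : Fin r → V →L[ℝ] V := fun i => LinearMap.toContinuousLinearMap (π (f i))
  -- The operator `-π(m(v(t)))` with the moment map frozen along `v`: a finite sum with continuous
  -- scalar coefficients, hence continuous in operator norm.
  let A : ℝ → V →L[ℝ] V := fun t => -∑ i, q i t • L i
  have hA : ContinuousOn A (Ico 0 T) :=
    (continuousOn_finsetSum _ fun i _ => (hq i).smul continuousOn_const).neg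
  have hA' : ∀ t w, -repDiff ρ (momentMap G K B ρ (v t)) w = A t w := fun t w => by
    rw [hm, hπ]
    simp [A, L, q, map_sum]
  have hvh : ∀ t ∈ Ico 0 T, v t = ρ (h t) vbar := by
    refine linearODE_unique (z := fun t => ρ (h t) vbar) hA (fun t ht => ?_) (fun t ht => ?_)
      (by rw [hv0, hh0])
    · rw [← hA']
      exact hvd t ht
    · rw [← hA']
      have := hρ.hasDerivWithinAt (hh t ht) vbar
      simpa [hπ] using this
  refine ⟨fun t => h t, (isLiftedFlow_iff hT).mpr ⟨hh0, fun t ht => ?_⟩, fun t => hvh t t.2⟩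
  rw [← hvh t ht]
  exact hh t ht

/-- The orbits `ρ(g)v̄` and `ρ(h)v̄` are gradient solutions and thus equal, so `g` and `h` solve one
linear equation with the same coefficient. -/
theorem liftedFlow_unique [FiniteDimensional ℝ V] (hB : IsLieScalarProduct G K B)
    (hρ : IsAlgebraicRep ρ) {vbar : V} (hv : vbar ≠ 0) {h₀ : G} (hT : 0 < T) {g h : Ico 0 T → G}
    (hg : IsLiftedFlow G K B ρ vbar h₀ hT g) (hh : IsLiftedFlow G K B ρ vbar h₀ hT h) : g = h := by
  have hgo := orbit_isGradientFlow hρ hv hT hg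
  have hgh := gradientFlow_unique hB hρ hT hgo (orbit_isGradientFlow hρ hv hT hh)
  obtain ⟨g, rfl⟩ := exists_eq_restrict g
  obtain ⟨h, rfl⟩ := exists_eq_restrict h
  rw [isGradientFlow_iff hT (v := fun t => ρ (g t) vbar)] at hgo
  rw [isLiftedFlow_iff] at hg hh
  have hY := continuousOn_neg_momentMap hB hρ
    (fun t ht => (hgo.2.2 t ht).continuousWithinAt) hgo.1
  funext ⟨t, ht⟩
  refine Subtype.ext (Units.ext ?_)
  refine linearODE_unique
    (A := fun t => ContinuousLinearMap.mul ℝ (Matrix (Fin n) (Fin n) ℝ)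
      (-momentMap G K B ρ (ρ (g t) vbar)).1)
    (y := fun t => ((g t).1 : Matrix (Fin n) (Fin n) ℝ))
    (z := fun t => ((h t).1 : Matrix (Fin n) (Fin n) ℝ))
    ((ContinuousLinearMap.continuous _).comp_continuousOn hY) (fun s hs => hg.2 s hs)
    (fun s hs => ?_) (by rw [hg.1, hh.1]) t ht
  have : ρ (g s) vbar = ρ (h s) vbar := congrFun hgh ⟨s, hs⟩
  rw [this]
  exact hh.2 s hs

end lift

end flows

/-! ### Invariant quadratic forms and maximal compact subgroups -/

section invariantForm

variable {n : ℕ}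

section haar

attribute [local instance] Matrix.linftyOpNormedRing Matrix.linftyOpNormedAlgebra

open MeasureTheory in
/-- A compact group of matrices leaves a positive definite form invariant. -/
theorem exists_invariant_posDef {K : Subgroup (GL (Fin n) ℝ)}
    (hK : IsCompact (K : Set (GL (Fin n) ℝ))) :
    ∃ Q : Matrix (Fin n) (Fin n) ℝ, Q.PosDef ∧ ∀ k ∈ K,
      (k : Matrix (Fin n) (Fin n) ℝ)ᵀ * Q * (k : Matrix (Fin n) (Fin n) ℝ) = Q := by
  have : CompactSpace K := isCompact_iff_compactSpace.mp hK
  let _ : MeasurableSpace K := borel K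
  have : BorelSpace K := ⟨rfl⟩
  let μ : Measure K := Measure.haar
  have : CompleteSpace (Matrix (Fin n) (Fin n) ℝ) := FiniteDimensional.complete ℝ _
  -- The inverses give `lᵀ f(k) l = f(l⁻¹k)`, so left invariance of Haar measure makes the integral
  -- of `f` invariant.
  let f : K → Matrix (Fin n) (Fin n) ℝ := fun k =>
    ((k⁻¹).1 : Matrix (Fin n) (Fin n) ℝ)ᵀ * ((k⁻¹).1 : Matrix (Fin n) (Fin n) ℝ)
  have hv : Continuous fun k : K => ((k⁻¹).1 : Matrix (Fin n) (Fin n) ℝ) :=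
    Units.continuous_val.comp (continuous_subtype_val.comp continuous_inv)
  have hf : Continuous f := hv.matrix_transpose.matrix_mul hv
  have hint : ∀ {E : Type} [NormedAddCommGroup E] {φ : K → E}, Continuous φ → Integrable φ μ :=
    fun hφ => hφ.integrable_of_hasCompactSupport (HasCompactSupport.of_compactSpace _)
  have hlin : ∀ {E : Type} [NormedAddCommGroup E] [NormedSpace ℝ E] [CompleteSpace E]
      (L : Matrix (Fin n) (Fin n) ℝ →ₗ[ℝ] E), L (∫ k, f k ∂μ) = ∫ k, L (f k) ∂μ := fun L =>
    ((LinearMap.toContinuousLinearMap L).integral_comp_comm (hint hf)).symm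
  refine ⟨∫ k, f k ∂μ, .of_dotProduct_mulVec_pos ?_ fun x hx => ?_, fun l hl => ?_⟩
  · have h1 := hlin (Matrix.transposeLinearEquiv (Fin n) (Fin n) ℝ ℝ).toLinearMap
    have h2 : ∀ k, (Matrix.transposeLinearEquiv (Fin n) (Fin n) ℝ ℝ).toLinearMap (f k) = f k :=
      fun k => by simp [f]
    simp only [h2] at h1
    rw [Matrix.IsHermitian, Matrix.conjTranspose_eq_transpose_of_trivial]
    exact h1
  · let L : Matrix (Fin n) (Fin n) ℝ →ₗ[ℝ] ℝ :=
      { toFun := fun A => x ⬝ᵥ A *ᵥ x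
        map_add' := fun A A' => by simp [Matrix.add_mulVec, dotProduct_add]
        map_smul' := fun c A => by simp [Matrix.smul_mulVec, dotProduct_smul] }
    have h1 := hlin L
    have h2 : ∀ k, L (f k) = (((k⁻¹).1 : Matrix (Fin n) (Fin n) ℝ) *ᵥ x) ⬝ᵥ
        (((k⁻¹).1 : Matrix (Fin n) (Fin n) ℝ) *ᵥ x) := fun k => by
      change x ⬝ᵥ (_ * _) *ᵥ x = _
      rw [← Matrix.mulVec_mulVec, Matrix.dotProduct_mulVec, Matrix.vecMul_transpose]
    have h3 : 0 < ∫ k, L (f k) ∂μ := by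
      refine Continuous.integral_pos_of_hasCompactSupport_nonneg_nonzero (x := 1)
        ((LinearMap.continuous_of_finiteDimensional L).comp hf)
        (HasCompactSupport.of_compactSpace _) (fun k => ?_) ?_
      · simp only [h2, Pi.zero_apply]
        exact Finset.sum_nonneg fun i _ => mul_self_nonneg _
      · rw [h2]
        simpa [dotProduct_self_eq_zero] using hx
    rw [← h1] at h3
    exact h3
  · let L : Matrix (Fin n) (Fin n) ℝ →ₗ[ℝ] Matrix (Fin n) (Fin n) ℝ :=
      { toFun := fun A => (l : Matrix (Fin n) (Fin n) ℝ)ᵀ * A * (l : Matrix (Fin n) (Fin n) ℝ)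
        map_add' := fun A A' => by simp [mul_add, add_mul]
        map_smul' := fun c A => by simp }
    have h1 := hlin L
    have h2 : ∀ k, L (f k) = f ((⟨l, hl⟩ : K)⁻¹ * k) := fun k => by
      change (l : Matrix (Fin n) (Fin n) ℝ)ᵀ * (((k⁻¹).1 : Matrix (Fin n) (Fin n) ℝ)ᵀ *
        ((k⁻¹).1 : Matrix (Fin n) (Fin n) ℝ)) * (l : Matrix (Fin n) (Fin n) ℝ) =
        ((((⟨l, hl⟩ : K)⁻¹ * k)⁻¹).1 : Matrix (Fin n) (Fin n) ℝ)ᵀ *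
        ((((⟨l, hl⟩ : K)⁻¹ * k)⁻¹).1 : Matrix (Fin n) (Fin n) ℝ)
      rw [mul_inv_rev, inv_inv]
      simp only [Subgroup.coe_mul, Units.val_mul, Matrix.transpose_mul, mul_assoc]
    simp only [h2] at h1
    rw [integral_mul_left_eq_self] at h1
    exact h1

end haar

open scoped MatrixOrder Matrix.Norms.L2Operator in
theorem exists_eq_transpose_mul_self {Q : Matrix (Fin n) (Fin n) ℝ} (hQ : Q.PosDef) :
    ∃ R : GL (Fin n) ℝ,
      Q = (R : Matrix (Fin n) (Fin n) ℝ)ᵀ * (R : Matrix (Fin n) (Fin n) ℝ) := by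
  obtain ⟨y, hy, rfl⟩ := CStarAlgebra.isStrictlyPositive_iff_eq_star_mul_self.mp
    hQ.isStrictlyPositive
  exact ⟨hy.unit, rfl⟩

theorem isCompact_transpose_mul_self_eq_one :
    IsCompact {U : Matrix (Fin n) (Fin n) ℝ | Uᵀ * U = 1} := by
  have h1 : IsCompact (Set.univ.pi fun _ : Fin n => Set.univ.pi fun _ : Fin n =>
      Set.Icc (-1 : ℝ) 1) := isCompact_univ_pi fun _ => isCompact_univ_pi fun _ => isCompact_Icc
  refine IsCompact.of_isClosed_subset (X := Fin n → Fin n → ℝ) h1 ?_ fun U hU => ?_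
  · exact isClosed_eq (X := Matrix (Fin n) (Fin n) ℝ)
      (continuous_id.matrix_transpose.matrix_mul continuous_id) continuous_const
  · refine fun i _ j _ => abs_le.mp ?_
    have hU' : U ∈ Matrix.unitaryGroup (Fin n) ℝ := Matrix.mem_unitaryGroup_iff'.mpr hU
    exact entry_norm_bound_of_unitary hU' i j

/-- With `Q = RᵀR` the set is `R⁻¹ O(n) R`. -/
theorem isCompact_preserving {Q : Matrix (Fin n) (Fin n) ℝ} (hQ : Q.PosDef) :
    IsCompact {A : Matrix (Fin n) (Fin n) ℝ | Aᵀ * Q * A = Q} := by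
  obtain ⟨R, rfl⟩ := exists_eq_transpose_mul_self hQ
  have hc : Continuous fun U : Matrix (Fin n) (Fin n) ℝ =>
      ((R⁻¹ : GL (Fin n) ℝ) : Matrix (Fin n) (Fin n) ℝ) * U * (R : Matrix (Fin n) (Fin n) ℝ) :=
    (continuous_const.matrix_mul continuous_id).matrix_mul continuous_const
  have e : (R : Matrix (Fin n) (Fin n) ℝ) * ((R⁻¹ : GL (Fin n) ℝ) : Matrix (Fin n) (Fin n) ℝ) = 1 :=
    Units.mul_inv R
  have e' : ((R⁻¹ : GL (Fin n) ℝ) : Matrix (Fin n) (Fin n) ℝ) * (R : Matrix (Fin n) (Fin n) ℝ) = 1 :=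
    Units.inv_mul R
  have et : ((R⁻¹ : GL (Fin n) ℝ) : Matrix (Fin n) (Fin n) ℝ)ᵀ *
      (R : Matrix (Fin n) (Fin n) ℝ)ᵀ = 1 := by
    rw [← Matrix.transpose_mul, e, Matrix.transpose_one]
  convert! isCompact_transpose_mul_self_eq_one.image hc using 1
  ext A
  constructor
  · intro hA
    refine ⟨(R : Matrix (Fin n) (Fin n) ℝ) * A *
      ((R⁻¹ : GL (Fin n) ℝ) : Matrix (Fin n) (Fin n) ℝ), ?_, ?_⟩
    · have hA' : Aᵀ * ((R : Matrix (Fin n) (Fin n) ℝ)ᵀ * (R : Matrix (Fin n) (Fin n) ℝ)) * A =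
        (R : Matrix (Fin n) (Fin n) ℝ)ᵀ * (R : Matrix (Fin n) (Fin n) ℝ) := hA
      change (_ * _ * _)ᵀ * (_ * _ * _) = 1
      simp only [Matrix.transpose_mul]
      calc _ = ((R⁻¹ : GL (Fin n) ℝ) : Matrix (Fin n) (Fin n) ℝ)ᵀ *
            (Aᵀ * ((R : Matrix (Fin n) (Fin n) ℝ)ᵀ * (R : Matrix (Fin n) (Fin n) ℝ)) * A) *
            ((R⁻¹ : GL (Fin n) ℝ) : Matrix (Fin n) (Fin n) ℝ) := by noncomm_ring
        _ = _ := by rw [hA', ← mul_assoc, et, one_mul, e]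
    · change _ * (_ * _ * _) * _ = _
      rw [mul_assoc, mul_assoc, mul_assoc, e', mul_one, ← mul_assoc, e', one_mul]
  · rintro ⟨U, hU, rfl⟩
    have hU' : Uᵀ * U = 1 := hU
    change (_ * _ * _)ᵀ * (_ * _) * (_ * _ * _) = _ * _
    simp only [Matrix.transpose_mul]
    calc _ = (R : Matrix (Fin n) (Fin n) ℝ)ᵀ * (Uᵀ *
          (((R⁻¹ : GL (Fin n) ℝ) : Matrix (Fin n) (Fin n) ℝ)ᵀ * (R : Matrix (Fin n) (Fin n) ℝ)ᵀ) *
          ((R : Matrix (Fin n) (Fin n) ℝ) * ((R⁻¹ : GL (Fin n) ℝ) : Matrix (Fin n) (Fin n) ℝ)) *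
          U) * (R : Matrix (Fin n) (Fin n) ℝ) := by noncomm_ring
      _ = _ := by rw [et, e, mul_one, mul_one, hU', mul_one]

/-- A maximal compact subgroup is the group of all elements of `G` that preserve a positive
definite form. -/
theorem IsMaximalCompact.exists_form {G K : Subgroup (GL (Fin n) ℝ)} (hG : IsLinearAlgebraic G)
    (hK : IsMaximalCompact G K) :
    ∃ Q : Matrix (Fin n) (Fin n) ℝ, ∀ g ∈ G, g ∈ K ↔
      (g : Matrix (Fin n) (Fin n) ℝ)ᵀ * Q * (g : Matrix (Fin n) (Fin n) ℝ) = Q := by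
  obtain ⟨Q, hQ, hKQ⟩ := exists_invariant_posDef hK.compact
  -- The stabilizer of `Q` in `G` contains `K`; once it is known to be compact, maximality forces
  -- equality.
  let L : Subgroup (GL (Fin n) ℝ) :=
    { carrier := {g | g ∈ G ∧
        (g : Matrix (Fin n) (Fin n) ℝ)ᵀ * Q * (g : Matrix (Fin n) (Fin n) ℝ) = Q}
      mul_mem' := by
        rintro a b ⟨ha, ha'⟩ ⟨hb, hb'⟩
        refine ⟨G.mul_mem ha hb, ?_⟩
        rw [Units.val_mul, Matrix.transpose_mul]
        calc _ = (b : Matrix (Fin n) (Fin n) ℝ)ᵀ * ((a : Matrix (Fin n) (Fin n) ℝ)ᵀ * Q *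
              (a : Matrix (Fin n) (Fin n) ℝ)) * (b : Matrix (Fin n) (Fin n) ℝ) := by noncomm_ring
          _ = Q := by rw [ha', hb']
      one_mem' := ⟨G.one_mem, by simp⟩
      inv_mem' := by
        rintro a ⟨ha, ha'⟩
        refine ⟨G.inv_mem ha, ?_⟩
        have e : (a : Matrix (Fin n) (Fin n) ℝ) *
          ((a⁻¹ : GL (Fin n) ℝ) : Matrix (Fin n) (Fin n) ℝ) = 1 := Units.mul_inv a
        have et : ((a⁻¹ : GL (Fin n) ℝ) : Matrix (Fin n) (Fin n) ℝ)ᵀ *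
            (a : Matrix (Fin n) (Fin n) ℝ)ᵀ = 1 := by
          rw [← Matrix.transpose_mul, e, Matrix.transpose_one]
        calc _ = ((a⁻¹ : GL (Fin n) ℝ) : Matrix (Fin n) (Fin n) ℝ)ᵀ *
              ((a : Matrix (Fin n) (Fin n) ℝ)ᵀ * Q * (a : Matrix (Fin n) (Fin n) ℝ)) *
              ((a⁻¹ : GL (Fin n) ℝ) : Matrix (Fin n) (Fin n) ℝ) := by rw [ha']
          _ = (((a⁻¹ : GL (Fin n) ℝ) : Matrix (Fin n) (Fin n) ℝ)ᵀ *
              (a : Matrix (Fin n) (Fin n) ℝ)ᵀ) * Q * ((a : Matrix (Fin n) (Fin n) ℝ) *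
              ((a⁻¹ : GL (Fin n) ℝ) : Matrix (Fin n) (Fin n) ℝ)) := by noncomm_ring
          _ = Q := by rw [et, e, one_mul, mul_one] }
  have hLc : IsCompact (L : Set (GL (Fin n) ℝ)) := by
    obtain ⟨S, hS⟩ := hG
    have hcl : IsClosed {A : Matrix (Fin n) (Fin n) ℝ | ∀ p ∈ S, evalMatrix A p = 0} := by
      simp only [Set.ofPred_forall]
      refine isClosed_biInter fun p _ => isClosed_eq ?_ continuous_const
      exact (MvPolynomial.continuous_eval p).comp
        (continuous_pi fun ij => continuous_id.matrix_elem ij.1 ij.2)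
    refine (isOpenEmbedding_val_GL.isInducing.isCompact_iff).mpr ?_
    convert! (isCompact_preserving hQ).inter_right hcl using 1
    ext A
    constructor
    · rintro ⟨g, ⟨hg, hg'⟩, rfl⟩
      have hg : g ∈ (G : Set (GL (Fin n) ℝ)) := hg
      rw [hS] at hg
      exact ⟨hg', hg⟩
    · rintro ⟨hA, hA'⟩
      -- Preserving `Q` forces invertibility since `det Q ≠ 0`, so compactness in the matrix space
      -- passes to `GL n ℝ`.
      have hdet : IsUnit A.det := by
        have h1 : (Aᵀ * Q * A).det = Q.det := congrArg Matrix.det hA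
        rw [Matrix.det_mul, Matrix.det_mul, Matrix.det_transpose] at h1
        refine isUnit_iff_ne_zero.mpr fun h0 => hQ.det_pos.ne' ?_
        rw [← h1, h0, mul_zero]
      let u : GL (Fin n) ℝ := ((Matrix.isUnit_iff_isUnit_det A).mpr hdet).unit
      have hu : u ∈ (G : Set (GL (Fin n) ℝ)) := by
        rw [hS]
        exact hA'
      exact ⟨u, ⟨hu, hA⟩, rfl⟩
  have hLK : L = K := hK.maximal L (fun g hg => hg.1) hLc fun k hk => ⟨hK.le hk, hKQ k hk⟩
  refine ⟨Q, fun g hg => ?_⟩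
  rw [← hLK]
  exact ⟨fun h => h.2, fun h => ⟨hg, h⟩⟩

end invariantForm

/-! ### Lifting solutions of the moment map flow -/

section lifting

open Set

variable {n : ℕ} {G K : Subgroup (GL (Fin n) ℝ)}

/-- The pull-back of the bilinear form `Q` by `g`. -/
def pullForm (Q : Matrix (Fin n) (Fin n) ℝ) (g : G) : Matrix (Fin n) (Fin n) ℝ :=
  (g.1 : Matrix (Fin n) (Fin n) ℝ)ᵀ * Q * (g.1 : Matrix (Fin n) (Fin n) ℝ)

/-- Equality of the forms means that `hg⁻¹` preserves `Q`, that is `hg⁻¹ ∈ K`. Thus `Kg ↦ gᵀQg`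
embeds `K\G` as a set into the matrices. -/
theorem pullForm_eq_iff {Q : Matrix (Fin n) (Fin n) ℝ}
    (hQ : ∀ g ∈ G, g ∈ K ↔
      (g : Matrix (Fin n) (Fin n) ℝ)ᵀ * Q * (g : Matrix (Fin n) (Fin n) ℝ) = Q) {g h : G} :
    pullForm Q g = pullForm Q h ↔ coset K g = coset K h := by
  have e : (g.1 : Matrix (Fin n) (Fin n) ℝ) * ((g⁻¹).1 : Matrix (Fin n) (Fin n) ℝ) = 1 :=
    Units.mul_inv g.1
  have e' : ((g⁻¹).1 : Matrix (Fin n) (Fin n) ℝ) * (g.1 : Matrix (Fin n) (Fin n) ℝ) = 1 :=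
    Units.inv_mul g.1
  have et : ((g⁻¹).1 : Matrix (Fin n) (Fin n) ℝ)ᵀ * (g.1 : Matrix (Fin n) (Fin n) ℝ)ᵀ = 1 := by
    rw [← Matrix.transpose_mul, e, Matrix.transpose_one]
  have et' : (g.1 : Matrix (Fin n) (Fin n) ℝ)ᵀ * ((g⁻¹).1 : Matrix (Fin n) (Fin n) ℝ)ᵀ = 1 := by
    rw [← Matrix.transpose_mul, e', Matrix.transpose_one]
  have h1 : coset K g = coset K h ↔ (h * g⁻¹).1 ∈ K := by
    rw [Quotient.eq]
    exact QuotientGroup.rightRel_apply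
  have h2 : (((h * g⁻¹).1 : GL (Fin n) ℝ) : Matrix (Fin n) (Fin n) ℝ)ᵀ * Q *
      (((h * g⁻¹).1 : GL (Fin n) ℝ) : Matrix (Fin n) (Fin n) ℝ) =
      ((g⁻¹).1 : Matrix (Fin n) (Fin n) ℝ)ᵀ * pullForm Q h *
        ((g⁻¹).1 : Matrix (Fin n) (Fin n) ℝ) := by
    simp only [pullForm, Subgroup.coe_mul, Units.val_mul, Matrix.transpose_mul, mul_assoc]
  rw [h1, hQ _ (h * g⁻¹).2, h2]
  constructor
  · intro h3
    rw [← h3, pullForm]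
    calc _ = (((g⁻¹).1 : Matrix (Fin n) (Fin n) ℝ)ᵀ * (g.1 : Matrix (Fin n) (Fin n) ℝ)ᵀ) * Q *
          ((g.1 : Matrix (Fin n) (Fin n) ℝ) * ((g⁻¹).1 : Matrix (Fin n) (Fin n) ℝ)) := by
          noncomm_ring
      _ = Q := by rw [et, e, one_mul, mul_one]
  · intro h3
    conv_lhs => rw [pullForm, ← h3]
    calc _ = ((g.1 : Matrix (Fin n) (Fin n) ℝ)ᵀ * ((g⁻¹).1 : Matrix (Fin n) (Fin n) ℝ)ᵀ) *
          pullForm Q h *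
          (((g⁻¹).1 : Matrix (Fin n) (Fin n) ℝ) * (g.1 : Matrix (Fin n) (Fin n) ℝ)) := by
          noncomm_ring
      _ = pullForm Q h := by rw [et', e', one_mul, mul_one]

theorem coset_out (c : LeftQuot G K) : coset K c.out = c :=
  Quotient.out_eq c

/-! ### The entries of `gᵀQg` as coordinates on `K\G`. -/

section form

attribute [local instance] Matrix.linftyOpNormedRing Matrix.linftyOpNormedAlgebra

theorem contDiff_form {m : WithTop ℕ∞} (Q : Matrix (Fin n) (Fin n) ℝ) (i j : Fin n) :
    ContDiff ℝ m (fun A : Fin n → Fin n → ℝ => ((Matrix.of A)ᵀ * Q * Matrix.of A) i j) := by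
  simp only [Matrix.mul_apply, Matrix.transpose_apply, Matrix.of_apply]
  fun_prop

theorem fderiv_form (Q A C : Matrix (Fin n) (Fin n) ℝ) (i j : Fin n) :
    fderiv ℝ (fun A : Fin n → Fin n → ℝ => ((Matrix.of A)ᵀ * Q * Matrix.of A) i j)
      (fun i j => A i j) (fun i j => C i j) = (Cᵀ * Q * A + Aᵀ * Q * C) i j := by
  have hl : HasDerivWithinAt (fun s : ℝ => A + s • C) C univ 0 := by
    have h1 : HasDerivAt (fun s : ℝ => A + s • C) ((1 : ℝ) • C) 0 :=
      ((hasDerivAt_id (0 : ℝ)).smul_const C).const_add A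
    rw [one_smul] at h1
    exact h1.hasDerivWithinAt
  have hlt : HasDerivWithinAt (fun s : ℝ => (A + s • C)ᵀ) Cᵀ univ 0 :=
    hasDerivWithinAt_matrix_iff.mpr fun i j => hasDerivWithinAt_matrix_iff.mp hl j i
  have h1 : HasDerivWithinAt (fun s : ℝ => (A + s • C)ᵀ * Q * (A + s • C))
      (Cᵀ * Q * A + Aᵀ * Q * C) univ 0 := by
    have := (hlt.mul_const Q).mul hl
    convert! this using 1
    simp
  have h2 := hasDerivWithinAt_univ.mp (hasDerivWithinAt_matrix_iff.mp h1 i j)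
  have h3 : HasDerivAt (fun s : ℝ => (fun i j => (A + s • C) i j : Fin n → Fin n → ℝ))
      (fun i j => C i j) 0 := (hasDerivWithinAt_univ (F := Fin n → Fin n → ℝ)).mp hl
  have h4 : HasFDerivAt (fun A : Fin n → Fin n → ℝ => ((Matrix.of A)ᵀ * Q * Matrix.of A) i j)
      (fderiv ℝ (fun A : Fin n → Fin n → ℝ => ((Matrix.of A)ᵀ * Q * Matrix.of A) i j)
        (fun i j => A i j)) ((fun s : ℝ => (fun i j => (A + s • C) i j : Fin n → Fin n → ℝ)) 0) := by
    have : ((fun s : ℝ => (fun i j => (A + s • C) i j : Fin n → Fin n → ℝ)) 0) =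
        fun i j => A i j := by simp
    rw [this]
    exact ((contDiff_form (m := 1) Q i j).differentiable (by simp) _).hasFDerivAt
  have h5 := h4.comp_hasDerivAt (0 : ℝ) h3
  exact h5.unique h2

/-- An entry of the pull-back of `Q`, as a function on `K\G`. -/
noncomputable def formEntry (Q : Matrix (Fin n) (Fin n) ℝ) (i j : Fin n) (c : LeftQuot G K) : ℝ :=
  pullForm Q c.out i j

variable {Q : Matrix (Fin n) (Fin n) ℝ}

theorem formEntry_coset (hQ : ∀ g ∈ G, g ∈ K ↔
      (g : Matrix (Fin n) (Fin n) ℝ)ᵀ * Q * (g : Matrix (Fin n) (Fin n) ℝ) = Q) (i j : Fin n)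
    (g : G) : formEntry Q i j (coset K g) = pullForm Q g i j := by
  rw [formEntry, (pullForm_eq_iff hQ).mpr (coset_out (coset K g))]

theorem isSmoothOnQuot_formEntry (hQ : ∀ g ∈ G, g ∈ K ↔
      (g : Matrix (Fin n) (Fin n) ℝ)ᵀ * Q * (g : Matrix (Fin n) (Fin n) ℝ) = Q) (i j : Fin n) :
    IsSmoothOnQuot (formEntry (G := G) (K := K) Q i j) := fun _ =>
  ⟨_, (contDiff_form Q i j).contDiffAt,
    Filter.Eventually.of_forall fun g => formEntry_coset hQ i j g⟩

/-- The differential is linear in the form itself; this is why curves in `K\G` can be compared by a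
linear equation. -/
theorem leftTranslateDiff_formEntry (hQ : ∀ g ∈ G, g ∈ K ↔
      (g : Matrix (Fin n) (Fin n) ℝ)ᵀ * Q * (g : Matrix (Fin n) (Fin n) ℝ) = Q) (i j : Fin n)
    (g : G) (X : lieAlg G) :
    leftTranslateDiff (coset K g) X (formEntry Q i j) =
      (X.1ᵀ * pullForm Q g + pullForm Q g * X.1) i j := by
  rw [leftTranslateDiff_coset ((contDiff_form (m := 1) Q i j).differentiable (by simp) _)
    (Filter.Eventually.of_forall fun g => formEntry_coset hQ i j g), fderiv_form]
  simp only [pullForm, Matrix.transpose_mul, mul_assoc]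

/-- Two curves in `K\G` with the same starting point and the same left invariant velocity
coincide. -/
theorem eq_of_velocity {T : ℝ} (hQ : ∀ g ∈ G, g ∈ K ↔
      (g : Matrix (Fin n) (Fin n) ℝ)ᵀ * Q * (g : Matrix (Fin n) (Fin n) ℝ) = Q)
    {X : ℝ → lieAlg G} (hX : ContinuousOn (fun t => (X t).1) (Ico 0 T)) {c d : ℝ → LeftQuot G K}
    (hc : ∀ t ∈ Ico 0 T, ∀ f : LeftQuot G K → ℝ, IsSmoothOnQuot f →
      HasDerivWithinAt (fun s => f (c s)) (-leftTranslateDiff (c t) (X t) f) (Ico 0 T) t)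
    (hd : ∀ t ∈ Ico 0 T, ∀ f : LeftQuot G K → ℝ, IsSmoothOnQuot f →
      HasDerivWithinAt (fun s => f (d s)) (-leftTranslateDiff (d t) (X t) f) (Ico 0 T) t)
    (h0 : c 0 = d 0) : ∀ t ∈ Ico 0 T, c t = d t := by
  let M := ContinuousLinearMap.mul ℝ (Matrix (Fin n) (Fin n) ℝ)
  -- The operator `P ↦ -(XᵀP + PX)` that governs the forms along both curves.
  let A : ℝ → Matrix (Fin n) (Fin n) ℝ →L[ℝ] Matrix (Fin n) (Fin n) ℝ := fun t =>
    -(M (X t).1ᵀ + M.flip (X t).1)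
  have hXt : ContinuousOn (fun t => (X t).1ᵀ) (Ico 0 T) :=
    continuous_id.matrix_transpose.comp_continuousOn hX
  have hA : ContinuousOn A (Ico 0 T) :=
    ((M.continuous.comp_continuousOn hXt).add (M.flip.continuous.comp_continuousOn hX)).neg
  have key : ∀ c : ℝ → LeftQuot G K, (∀ t ∈ Ico 0 T, ∀ f : LeftQuot G K → ℝ, IsSmoothOnQuot f →
      HasDerivWithinAt (fun s => f (c s)) (-leftTranslateDiff (c t) (X t) f) (Ico 0 T) t) →
      ∀ t ∈ Ico 0 T, HasDerivWithinAt (fun s => pullForm Q (c s).out)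
        (A t (pullForm Q (c t).out)) (Ico 0 T) t := by
    intro c hc t ht
    refine hasDerivWithinAt_matrix_iff.mpr fun i j => ?_
    have h1 := hc t ht _ (isSmoothOnQuot_formEntry hQ i j)
    rw [← coset_out (c t), leftTranslateDiff_formEntry hQ] at h1
    exact h1
  intro t ht
  have h1 := linearODE_unique hA (key c hc) (key d hd) (by rw [h0]) t ht
  rw [← coset_out (c t), ← coset_out (d t)]
  exact (pullForm_eq_iff hQ).mp h1

/-- Passes from `u' = Xu`, which `exists_groupFlow` solves, to `h' = -hX` for `h = u⁻¹`. -/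
theorem hasDerivWithinAt_inv {u : ℝ → G} {X : Matrix (Fin n) (Fin n) ℝ} {s : Set ℝ} {t : ℝ}
    (hu : HasDerivWithinAt (fun s => ((u s).1 : Matrix (Fin n) (Fin n) ℝ))
      (X * ((u t).1 : Matrix (Fin n) (Fin n) ℝ)) s t) :
    HasDerivWithinAt (fun s => (((u s)⁻¹).1 : Matrix (Fin n) (Fin n) ℝ))
      (-((((u t)⁻¹).1 : Matrix (Fin n) (Fin n) ℝ) * X)) s t := by
  have : CompleteSpace (Matrix (Fin n) (Fin n) ℝ) := FiniteDimensional.complete ℝ _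
  have h1 := hasFDerivAt_ringInverse (𝕜 := ℝ) (((u t).1 : (Matrix (Fin n) (Fin n) ℝ)ˣ))
  have h2 := h1.comp_hasDerivWithinAt t hu
  have e : (Ring.inverse ∘ fun t => ((u t).1 : Matrix (Fin n) (Fin n) ℝ)) =
      fun t => (((u t)⁻¹).1 : Matrix (Fin n) (Fin n) ℝ) := by
    funext t
    exact Ring.inverse_unit _
  rw [e] at h2
  convert! h2 using 1
  simp [mul_assoc]

end form

theorem contDiff_adjugate {m : WithTop ℕ∞} (i j : Fin n) :
    ContDiff ℝ m (fun A : Fin n → Fin n → ℝ => (Matrix.of A).adjugate i j) := by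
  simp only [Matrix.adjugate_apply]
  refine contDiff_matrix_det.comp (g := fun A : Fin n → Fin n → ℝ => (Matrix.of A).det)
    (f := fun A : Fin n → Fin n → ℝ => (Matrix.of A).updateRow j (Pi.single i 1)) ?_
  refine contDiff_pi.mpr fun k => contDiff_pi.mpr fun l => ?_
  by_cases hk : k = j
  · subst hk
    simpa using contDiff_const
  · simp only [Matrix.updateRow_ne hk, Matrix.of_apply]
    fun_prop

variable {B : LinearMap.BilinForm ℝ (lieAlg G)}
  {V : Type*} [NormedAddCommGroup V] [InnerProductSpace ℝ V] [FiniteDimensional ℝ V]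
  {ρ : Representation ℝ G V}

/-- Velocities in `K\G` are tested only on smooth functions. Using these entries as test functions
yields continuity of the moment map along any solution. The local extension comes from `A⁻¹ m(F(A))
A`, with `A⁻¹` written through the adjugate. -/
theorem isSmoothOnQuot_momentMapTranslate (hKG : K ≤ G) (hB : IsLieScalarProduct G K B)
    (hρ : IsAlgebraicRep ρ) (hV : IsAdapted G K ρ) {vbar : V} (hv : vbar ≠ 0) (i j : Fin n) :
    IsSmoothOnQuot fun c : LeftQuot G K => (momentMapTranslate G K B ρ c.out⁻¹ vbar).1 i j := by
  intro g
  obtain ⟨F, hF, hφ⟩ := hρ.exists_contDiffAt vbar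
  refine ⟨fun A => ∑ l, (∑ k, ((Matrix.of A).det⁻¹ * (Matrix.of A).adjugate i k) *
    (momentMap G K B ρ (F A)).1 k l) * A l j, ?_, Filter.Eventually.of_forall fun g => ?_⟩
  · have hdet := det_coe_ne_zero g.1
    have hg : F (fun i j => (g.1 : Matrix (Fin n) (Fin n) ℝ) i j) ≠ 0 := by
      rw [← hφ]
      intro h0
      have := congrArg (ρ g⁻¹) h0
      exact hv (by simpa [← Module.End.mul_apply, ← map_mul] using this)
    refine ContDiffAt.sum fun l _ => ContDiffAt.mul (ContDiffAt.sum fun k _ =>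
      ContDiffAt.mul (ContDiffAt.mul ?_ (contDiff_adjugate i k).contDiffAt) ?_) (by fun_prop)
    · exact contDiff_matrix_det.contDiffAt.inv hdet
    · exact ContDiffAt.comp (g := fun v => (momentMap G K B ρ v).1 k l) _
        (contDiffAt_momentMap hB hρ k l hg) (hF _ hdet)
  · have hinv : ((g⁻¹).1 : Matrix (Fin n) (Fin n) ℝ) =
        (g.1 : Matrix (Fin n) (Fin n) ℝ).det⁻¹ • (g.1 : Matrix (Fin n) (Fin n) ℝ).adjugate := by
      have h1 : ((g⁻¹).1 : Matrix (Fin n) (Fin n) ℝ) = (g.1 : Matrix (Fin n) (Fin n) ℝ)⁻¹ :=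
        Matrix.coe_units_inv g.1
      rw [h1, Matrix.inv_def, Ring.inverse_eq_inv']
    change (momentMapTranslate G K B ρ (coset K g).out⁻¹ vbar).1 i j = _
    rw [momentMapTranslate_inv_congr hKG hB hρ hV (coset_out (coset K g)), momentMapTranslate_inv,
      hφ]
    change (((g⁻¹).1 : Matrix (Fin n) (Fin n) ℝ) * (momentMap G K B ρ (F fun i j =>
      (g.1 : Matrix (Fin n) (Fin n) ℝ) i j)).1 * ((g⁻¹⁻¹).1 : Matrix (Fin n) (Fin n) ℝ)) i j = _
    rw [inv_inv, hinv]
    simp only [Matrix.mul_apply, Matrix.smul_apply, smul_eq_mul]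
    rfl

/-- Solutions of the moment map flow are the images of lifted flows. -/
theorem exists_liftedFlow_of_momentMapFlow (hG : IsLinearAlgebraic G) (hK : IsMaximalCompact G K)
    (hB : IsLieScalarProduct G K B) (hρ : IsAlgebraicRep ρ) (hV : IsAdapted G K ρ) {vbar : V}
    (hv : vbar ≠ 0) {h₀ : G} {T : ℝ} (hT : 0 < T) {c : Ico 0 T → LeftQuot G K}
    (hc : IsMomentMapFlow G K B ρ vbar (coset K h₀) hT c) :
    ∃ h : Ico 0 T → G, IsLiftedFlow G K B ρ vbar h₀ hT h ∧ ∀ t, c t = coset K (h t) := by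
  have : Nonempty (LeftQuot G K) := ⟨coset K 1⟩
  obtain ⟨c, rfl⟩ := exists_eq_restrict c
  obtain ⟨hc0, hc⟩ := hc
  let X : ℝ → lieAlg G := fun t => momentMapTranslate G K B ρ (c t).out⁻¹ vbar
  have hcd : ∀ t ∈ Ico 0 T, ∀ f : LeftQuot G K → ℝ, IsSmoothOnQuot f →
      HasDerivWithinAt (fun s => f (c s)) (-leftTranslateDiff (c t) (X t) f) (Ico 0 T) t :=
    fun t ht f hf => (hasDerivIco_iff (u := fun s => f (c s))).mp
      (hc ⟨t, ht⟩ (c t).out (coset_out (c t)) f hf)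
  have hX : ContinuousOn (fun t => (X t).1) (Ico 0 T) :=
    continuousOn_pi.mpr fun i => continuousOn_pi.mpr fun j t ht => (hcd t ht _
      (isSmoothOnQuot_momentMapTranslate hK.le hB hρ hV hv i j)).continuousWithinAt
  -- The desired lift is `h = u⁻¹`, hence the initial value `h₀⁻¹`.
  obtain ⟨u, hu0, hu⟩ := exists_groupFlow hG hX (fun t _ => (X t).2) h₀⁻¹
  have hud : ∀ t ∈ Ico 0 T, HasDerivWithinAt
      (fun s => (((u s)⁻¹).1 : Matrix (Fin n) (Fin n) ℝ))
      (-((((u t)⁻¹).1 : Matrix (Fin n) (Fin n) ℝ) * (X t).1)) (Ico 0 T) t := fun t ht =>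
    hasDerivWithinAt_inv (hu t ht)
  obtain ⟨Q, hQ⟩ := hK.exists_form hG
  have hcu : ∀ t ∈ Ico 0 T, c t = coset K (u t)⁻¹ := by
    refine eq_of_velocity hQ hX hcd (d := fun t => coset K (u t)⁻¹)
      (fun t ht f hf => hasDerivWithinAt_coset hf (hud t ht) ht) ?_
    rw [hu0, inv_inv]
    exact hc0
  refine ⟨fun t => (u t)⁻¹, (isLiftedFlow_iff hT (h := fun t => (u t)⁻¹)).mpr
    ⟨by rw [hu0, inv_inv], fun t ht => ?_⟩, fun t => hcu t t.2⟩
  -- `X` was defined by representatives of `c t`. Since `c t = K(u t)⁻¹`, it equals the coefficient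
  -- in the lifted equation.
  have hXt : X t = momentMapTranslate G K B ρ (u t)⁻¹⁻¹ vbar :=
    momentMapTranslate_inv_congr hK.le hB hρ hV ((coset_out (c t)).trans (hcu t ht)) vbar
  have h1 := hud t ht
  rw [hXt, mul_momentMapTranslate_inv, ← neg_mul] at h1
  exact h1

end lifting

end MomentFlow

/-! ### The bijection between the two sets of solutions. -/

theorem mainTheorem2 {n : ℕ} (G K : Subgroup (GL (Fin n) ℝ))
    (hG : MomentFlow.IsRealReductive G) (hK : MomentFlow.IsMaximalCompact G K)
    (B : LinearMap.BilinForm ℝ (MomentFlow.lieAlg G)) (hB : MomentFlow.IsLieScalarProduct G K B)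
    {V : Type*} [NormedAddCommGroup V] [InnerProductSpace ℝ V] [FiniteDimensional ℝ V]
    (ρ : Representation ℝ G V) (hρ : MomentFlow.IsAlgebraicRep ρ)
    (hV : MomentFlow.IsAdapted G K ρ)
    (vbar : V) (hvbar : vbar ≠ 0) (h₀ : G) (T : ℝ) (hT : 0 < T) :
    ∃ Φ : {v : Set.Ico 0 T → V // MomentFlow.IsGradientFlow G K B ρ (ρ h₀ vbar) hT v} ≃
        {c : Set.Ico 0 T → MomentFlow.LeftQuot G K //
          MomentFlow.IsMomentMapFlow G K B ρ vbar (MomentFlow.coset K h₀) hT c},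
      ∀ v, ∃ h : Set.Ico 0 T → G, MomentFlow.IsLiftedFlow G K B ρ vbar h₀ hT h ∧
        ∀ t, v.1 t = ρ (h t) vbar ∧ (Φ v).1 t = MomentFlow.coset K (h t) := by
  have hA := hG.algebraic
  choose h hh hvh using fun v : {v : Set.Ico 0 T → V //
    MomentFlow.IsGradientFlow G K B ρ (ρ h₀ vbar) hT v} =>
    MomentFlow.exists_liftedFlow hA hB hρ hT v.2
  let φ : {v : Set.Ico 0 T → V // MomentFlow.IsGradientFlow G K B ρ (ρ h₀ vbar) hT v} →
      {c : Set.Ico 0 T → MomentFlow.LeftQuot G K //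
        MomentFlow.IsMomentMapFlow G K B ρ vbar (MomentFlow.coset K h₀) hT c} := fun v =>
    ⟨fun t => MomentFlow.coset K (h v t),
      MomentFlow.coset_isMomentMapFlow hK.le hB hρ hV hT (hh v)⟩
  have hφ : Function.Bijective φ := by
    -- Injectivity is immediate because there is at most one gradient solution.
    refine ⟨fun v w _ => Subtype.ext (MomentFlow.gradientFlow_unique hB hρ hT v.2 w.2),
      fun c => ?_⟩
    obtain ⟨g, hg, hcg⟩ :=
      MomentFlow.exists_liftedFlow_of_momentMapFlow hA hK hB hρ hV hvbar hT c.2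
    let v : {v : Set.Ico 0 T → V // MomentFlow.IsGradientFlow G K B ρ (ρ h₀ vbar) hT v} :=
      ⟨fun t => ρ (g t) vbar, MomentFlow.orbit_isGradientFlow hρ hvbar hT hg⟩
    refine ⟨v, Subtype.ext (funext fun t => ?_)⟩
    -- The lift chosen for `v = ρ(g)v̄` must be `g` itself, by uniqueness of lifts.
    have hvg : h v = g := MomentFlow.liftedFlow_unique hB hρ hvbar hT (hh v) hg
    rw [hcg t, ← hvg]
  exact ⟨Equiv.ofBijective φ hφ, fun v => ⟨h v, hh v, fun t => ⟨hvh v t, rfl⟩⟩⟩
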